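/- Let $d\ge 1$ and identify $z=x+iy\in\mathbb C^d$ with $(x,y)\in\mathbb R^d\times\mathbb R^d$, with Lebesgue measure $dz$ and Euclidean norm $|z|$. For $n\in\mathbb N_0$ let $h_n(t)=(2^n n!\sqrt\pi)^{-1/2}H_n(t)e^{-t^2/2}$ be the normalized Hermite function on $\mathbb R$ ($H_n$ the physicists' Hermite polynomial), and for $\alpha\in\mathbb N_0^d$ put $\Phi_\alpha(\xi)=\prod_{j=1}^d h_{\alpha_j}(\xi_j)$. For $\alpha,\beta\in\mathbb N_0^d$ the special Hermite function on $\mathbb C^d$ is $$\Phi_{\alpha,\beta}(z)=(2\pi)^{-d/2}\int_{\mathbb R^d}e^{i x\cdot\xi}\,\Phi_\alpha\big(\xi+\tfrac12 y\big)\Phi_\beta\big(\xi-\tfrac12 y\big)\,d\xi,\qquad z=x+iy .$$ For $\mu\in 2\mathbb N_0+d=\{2k+d:k\in\mathbb N_0\}$ and $f\in L^2(\mathbb C^d)$ let $$\mathcal P_\mu f=\sum_{\beta\in\mathbb N_0^d:\,2|\beta|+d=\mu}\ \sum_{\alpha\in\mathbb N_0^d}\langle f,\Phi_{\alpha,\beta}\rangle\,\Phi_{\alpha,\beta},$$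 where $|\beta|=\sum_j\beta_j$, $\langle f,g\rangle=\int_{\mathbb C^d} f\,\overline{g}\,dz$, and the series over $\alpha$ is taken in $L^2(\mathbb C^d)$. Then there is a constant $C>0$, depending only on $d$, such that for all $\mu\in 2\mathbb N_0+d$ and all $f\in L^2(\mathbb C^d)$, the series over $\alpha$ defining $\mathcal P_\mu f$ converge unconditionally in $L^2(\mathbb C^d)$, and for all $M\ge 1$, $$\int_{|z|\le M}|\mathcal P_\mu f(z)|^2\,dz\le C\,M\,\mu^{-1/2}\,\|f\|_{L^2(\mathbb C^d)}^2 .$$ -/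

import Mathlib

open MeasureTheory FourierTransform
open scoped InnerProductSpace

namespace TwistedLaplacian

/-- The normalized Hermite function `(2ⁿ n! √π)^(-1/2) Hₙ(t) e^(-t²/2)` on the real line.
Mathlib's `Polynomial.hermite` is the probabilists' polynomial `Heₙ`, and
`Hₙ(t) = 2^(n/2) Heₙ(√2 t)`; this cancels the factor `2^(-n/2)` of the normalization. -/
noncomputable def hermiteFunction (n : ℕ) (t : ℝ) : ℝ :=
  Polynomial.aeval (Real.sqrt 2 * t) (Polynomial.hermite n)
    / Real.sqrt (n.factorial * Real.sqrt Real.pi) * Real.exp (-t ^ 2 / 2)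

/-- The normalized Hermite function `Φ_α` on `ℝ^d`. -/
noncomputable def hermiteFunctionPi {d : ℕ} (α : Fin d → ℕ) (x : Fin d → ℝ) : ℝ :=
  ∏ j, hermiteFunction (α j) (x j)

/-- The special Hermite function `Φ_{α,β}` on `ℂ^d`, where `z = x + i y`:
`(2π)^(-d/2) ∫ e^(i x·ξ) Φ_α(ξ + y/2) Φ_β(ξ - y/2) dξ`. -/
noncomputable def specialHermite {d : ℕ} (α β : Fin d → ℕ) (z : Fin d → ℂ) : ℂ :=
  (((2 * Real.pi) ^ (-(d : ℝ) / 2) : ℝ) : ℂ) *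
    ∫ ξ : Fin d → ℝ, Complex.exp (Complex.I * ((∑ j, (z j).re * ξ j : ℝ) : ℂ)) *
      (hermiteFunctionPi α (fun j => ξ j + (z j).im / 2) : ℂ) *
      (hermiteFunctionPi β (fun j => ξ j - (z j).im / 2) : ℂ)

theorem integrable_pow_mul_gauss (n : ℕ) {b : ℝ} (hb : 0 < b) :
    Integrable (fun x : ℝ => x ^ n * Real.exp (-b * x ^ 2)) := by
  have h := integrable_rpow_mul_exp_neg_mul_sq hb (s := (n : ℝ))
    (by have : (0 : ℝ) ≤ n := n.cast_nonneg
        linarith)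
  simpa only [Real.rpow_natCast] using h

theorem integrable_gaussMonomial (n : ℕ) :
    Integrable (fun v : ℝ => (v : ℂ) ^ n * Complex.exp (-(v : ℂ) ^ 2)) := by
  have h := (integrable_pow_mul_gauss n one_pos).ofReal (𝕜 := ℂ)
  refine h.congr (Filter.Eventually.of_forall fun v => ?_)
  simp

theorem fourier_gaussMonomial (n : ℕ) : ∃ P : Polynomial ℂ, ∀ w : ℝ,
    𝓕 (fun v : ℝ => (v : ℂ) ^ n * Complex.exp (-(v : ℂ) ^ 2)) w
      = P.eval (w : ℂ) * Complex.exp (-(Real.pi : ℂ) ^ 2 * (w : ℂ) ^ 2) := by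
  induction n with
  | zero =>
    refine ⟨Polynomial.C ((Real.pi : ℂ) ^ (1 / 2 : ℂ)), fun w => ?_⟩
    have h := fourierIntegral_gaussian (b := 1) (by simp) (-2 * Real.pi * w : ℂ)
    rw [Real.fourier_real_eq_integral_exp_smul]
    simp only [smul_eq_mul, pow_zero, one_mul, Polynomial.eval_C]
    convert h using 1
    · congr 1
      ext v
      push_cast
      ring_nf
    · simp only [div_one]
      congr 2
      ring
  | succ n ih =>
    obtain ⟨P, hP⟩ := ih
    have hd : ∀ w : ℝ, HasDerivAt
        (𝓕 (fun v : ℝ => (v : ℂ) ^ n * Complex.exp (-(v : ℂ) ^ 2)))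
        ((-2 * Real.pi * Complex.I) *
          𝓕 (fun v : ℝ => (v : ℂ) ^ (n + 1) * Complex.exp (-(v : ℂ) ^ 2)) w) w := by
      intro w
      have h := Real.hasDerivAt_fourier (integrable_gaussMonomial n)
        (by
          refine (integrable_gaussMonomial (n + 1)).congr
            (Filter.Eventually.of_forall fun v => ?_)
          simp [pow_succ]; ring) w
      have he : (-2 * Real.pi * Complex.I) *
          𝓕 (fun v : ℝ => (v : ℂ) ^ (n + 1) * Complex.exp (-(v : ℂ) ^ 2)) w
          = 𝓕 (fun x : ℝ => (-2 * Real.pi * Complex.I * (x : ℂ)) •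
              ((x : ℂ) ^ n * Complex.exp (-(x : ℂ) ^ 2))) w := by
        rw [Real.fourier_real_eq_integral_exp_smul, Real.fourier_real_eq_integral_exp_smul,
          ← integral_const_mul]
        congr 1
        ext v
        simp only [smul_eq_mul]
        ring
      rw [he]
      exact h
    refine ⟨Polynomial.C ((-2 * Real.pi * Complex.I)⁻¹) *
      (Polynomial.derivative P
        - Polynomial.C (2 * (Real.pi : ℂ) ^ 2) * Polynomial.X * P), fun w => ?_⟩
    have h2 : HasDerivAt
        (fun w : ℝ => P.eval (w : ℂ) * Complex.exp (-(Real.pi : ℂ) ^ 2 * (w : ℂ) ^ 2))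
        ((Polynomial.derivative P).eval (w : ℂ) *
            Complex.exp (-(Real.pi : ℂ) ^ 2 * (w : ℂ) ^ 2)
          + P.eval (w : ℂ) * (Complex.exp (-(Real.pi : ℂ) ^ 2 * (w : ℂ) ^ 2) *
            (-(Real.pi : ℂ) ^ 2 * (2 * (w : ℂ))))) w := by
      have hp := (P.hasDerivAt (w : ℂ)).comp_ofReal
      have he : HasDerivAt (fun z : ℂ => Complex.exp (-(Real.pi : ℂ) ^ 2 * z ^ 2))
          (Complex.exp (-(Real.pi : ℂ) ^ 2 * (w : ℂ) ^ 2) *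
            (-(Real.pi : ℂ) ^ 2 * (2 * (w : ℂ)))) (w : ℂ) := by
        have := ((hasDerivAt_pow 2 (w : ℂ)).const_mul (-(Real.pi : ℂ) ^ 2)).cexp
        simpa using this
      exact hp.mul he.comp_ofReal
    have h1 := hd w
    rw [funext hP] at h1
    have h3 := h1.unique h2
    have hpi : (-2 * Real.pi * Complex.I : ℂ) ≠ 0 := by
      simp [Real.pi_ne_zero, Complex.I_ne_zero]
    rw [← mul_right_inj' hpi, h3]
    simp only [Polynomial.eval_mul, Polynomial.eval_C, Polynomial.eval_sub, Polynomial.eval_X]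
    rw [mul_assoc _⁻¹, mul_inv_cancel_left₀ hpi]
    ring

theorem integral_gaussMonomial (n : ℕ) : ∃ P : Polynomial ℂ, ∀ x : ℝ,
    ∫ v : ℝ, Complex.exp (Complex.I * ((x * v : ℝ) : ℂ)) *
      ((v : ℂ) ^ n * Complex.exp (-(v : ℂ) ^ 2))
      = P.eval (x : ℂ) * Complex.exp (-(x : ℂ) ^ 2 / 4) := by
  obtain ⟨P, hP⟩ := fourier_gaussMonomial n
  refine ⟨P.comp (Polynomial.C (-(2 * (Real.pi : ℂ))⁻¹) * Polynomial.X), fun x => ?_⟩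
  have h := hP (-(2 * Real.pi)⁻¹ * x)
  rw [Real.fourier_real_eq_integral_exp_smul] at h
  have hpi : (Real.pi : ℂ) ≠ 0 := by simp [Real.pi_ne_zero]
  simp only [Polynomial.eval_comp, Polynomial.eval_mul, Polynomial.eval_C, Polynomial.eval_X]
  convert h using 1
  · congr 1
    ext v
    simp only [smul_eq_mul]
    congr 2
    push_cast
    field_simp
  · push_cast
    congr 2
    field_simp
    norm_num

theorem memLp_poly_gauss (P : Polynomial ℂ) :
    MemLp (fun x : ℝ => P.eval (x : ℂ) * Complex.exp (-(x : ℂ) ^ 2 / 4)) 2 := by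
  have hmon : ∀ n : ℕ, MemLp (fun x : ℝ => (x : ℂ) ^ n * Complex.exp (-(x : ℂ) ^ 2 / 4)) 2 := by
    intro n
    rw [memLp_two_iff_integrable_sq_norm (by fun_prop)]
    refine (integrable_pow_mul_gauss (2 * n) (b := 1 / 2) (by norm_num)).congr
      (Filter.Eventually.of_forall fun x => ?_)
    have hx : (-(x : ℂ) ^ 2 / 4) = ((-x ^ 2 / 4 : ℝ) : ℂ) := by push_cast; ring
    simp only [norm_mul, norm_pow, hx, Complex.norm_exp_ofReal, Complex.norm_real, mul_pow]
    rw [← pow_mul, mul_comm n 2, pow_mul ‖x‖ 2 n, ← Real.exp_nat_mul, Real.norm_eq_abs, sq_abs,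
      ← pow_mul]
    congr 2
    push_cast
    ring
  simp only [Polynomial.eval_eq_sum_range, Finset.sum_mul, mul_assoc]
  exact memLp_finsetSum _ fun n _ => (hmon n).const_mul _

theorem memLp_re_mul_im {f g : ℝ → ℂ} (hf : MemLp f 2) (hg : MemLp g 2) :
    MemLp (fun z : ℂ => f z.re * g z.im) 2 := by
  have h1 : MemLp (fun p : ℝ × ℝ => f p.1 * g p.2) 2 := by
    have hm : AEStronglyMeasurable (fun p : ℝ × ℝ => f p.1 * g p.2) volume :=
      hf.1.comp_fst.mul hg.1.comp_snd
    rw [memLp_two_iff_integrable_sq_norm hm]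
    have := Integrable.mul_prod ((memLp_two_iff_integrable_sq_norm hf.1).1 hf)
      ((memLp_two_iff_integrable_sq_norm hg.1).1 hg)
    simp only [norm_mul, mul_pow]
    exact this
  exact h1.comp_measurePreserving Complex.volume_preserving_equiv_real_prod

theorem eval_map_aeval (S : Polynomial (Polynomial ℂ)) (y ξ : ℂ) (s : ℝ) (p : Polynomial ℤ)
    (h : (S.map (Polynomial.evalRingHom y)).eval ξ = (s : ℂ)) :
    ((Polynomial.aeval S p).map (Polynomial.evalRingHom y)).eval ξ
      = ((Polynomial.aeval s p : ℝ) : ℂ) := by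
  have h1 := Polynomial.map_aeval_eq_aeval_map
    (φ := RingHom.id ℤ)
    (ψ := (Polynomial.evalRingHom ξ).comp (Polynomial.mapRingHom (Polynomial.evalRingHom y)))
    (RingHom.ext_int _ _) p S
  have h2 := Polynomial.map_aeval_eq_aeval_map
    (φ := RingHom.id ℤ) (ψ := Complex.ofRealHom) (RingHom.ext_int _ _) p s
  simp only [Polynomial.map_id, RingHom.comp_apply, Polynomial.coe_mapRingHom,
    Polynomial.coe_evalRingHom, Complex.ofRealHom_eq_coe] at h1 h2
  rw [h1, h2, h]

theorem memLp_specialHermite_one (a b : ℕ) :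
    MemLp (fun z : ℂ => ∫ ξ : ℝ, Complex.exp (Complex.I * ((z.re * ξ : ℝ) : ℂ)) *
      (hermiteFunction a (ξ + z.im / 2) : ℂ) * (hermiteFunction b (ξ - z.im / 2) : ℂ)) 2 := by
  choose P hP using integral_gaussMonomial
  let A : Polynomial (Polynomial ℂ) := Polynomial.aeval
    (Polynomial.C (Polynomial.C (Real.sqrt 2 : ℂ)) *
      (Polynomial.X + Polynomial.C (Polynomial.C (1 / 2 : ℂ) * Polynomial.X)))
    (Polynomial.hermite a)
  let B : Polynomial (Polynomial ℂ) := Polynomial.aeval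
    (Polynomial.C (Polynomial.C (Real.sqrt 2 : ℂ)) *
      (Polynomial.X - Polynomial.C (Polynomial.C (1 / 2 : ℂ) * Polynomial.X)))
    (Polynomial.hermite b)
  let Q := A * B
  let ca : ℂ := (Real.sqrt (a.factorial * Real.sqrt Real.pi) : ℝ)
  let cb : ℂ := (Real.sqrt (b.factorial * Real.sqrt Real.pi) : ℝ)
  have hQ : ∀ y ξ : ℝ, (hermiteFunction a (ξ + y / 2) : ℂ) * (hermiteFunction b (ξ - y / 2) : ℂ)
      = ca⁻¹ * cb⁻¹ * Complex.exp (-(y : ℂ) ^ 2 / 4) * ((Q.map (Polynomial.evalRingHom (y : ℂ))).eval (ξ : ℂ)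
          * Complex.exp (-(ξ : ℂ) ^ 2)) := by
    intro y ξ
    have hA : (A.map (Polynomial.evalRingHom (y : ℂ))).eval (ξ : ℂ)
        = ((Polynomial.aeval (Real.sqrt 2 * (ξ + y / 2)) (Polynomial.hermite a) : ℝ) : ℂ) :=
      eval_map_aeval _ _ _ _ _ (by simp; ring)
    have hB : (B.map (Polynomial.evalRingHom (y : ℂ))).eval (ξ : ℂ)
        = ((Polynomial.aeval (Real.sqrt 2 * (ξ - y / 2)) (Polynomial.hermite b) : ℝ) : ℂ) :=
      eval_map_aeval _ _ _ _ _ (by simp; ring)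
    have he : Complex.exp (-((ξ : ℂ) + y / 2) ^ 2 / 2) * Complex.exp (-((ξ : ℂ) - y / 2) ^ 2 / 2)
        = Complex.exp (-(y : ℂ) ^ 2 / 4) * Complex.exp (-(ξ : ℂ) ^ 2) := by
      rw [← Complex.exp_add, ← Complex.exp_add]
      congr 1
      ring
    simp only [hermiteFunction, Q, Polynomial.map_mul, Polynomial.eval_mul, hA, hB]
    push_cast
    linear_combination (Polynomial.aeval (Real.sqrt 2 * (ξ + y / 2)) (Polynomial.hermite a) : ℝ) *
      (Polynomial.aeval (Real.sqrt 2 * (ξ - y / 2)) (Polynomial.hermite b) : ℝ) * ca⁻¹ * cb⁻¹ * he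
  have key : ∀ z : ℂ, ∫ ξ : ℝ, Complex.exp (Complex.I * ((z.re * ξ : ℝ) : ℂ)) *
      (hermiteFunction a (ξ + z.im / 2) : ℂ) * (hermiteFunction b (ξ - z.im / 2) : ℂ)
      = ∑ n ∈ Finset.range (Q.natDegree + 1), (ca⁻¹ * cb⁻¹) *
        (((P n).eval (z.re : ℂ) * Complex.exp (-(z.re : ℂ) ^ 2 / 4)) *
          ((Q.coeff n).eval (z.im : ℂ) * Complex.exp (-(z.im : ℂ) ^ 2 / 4))) := by
    intro z
    have hint : ∀ n : ℕ, Integrable (fun ξ : ℝ =>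
        Complex.exp (Complex.I * ((z.re * ξ : ℝ) : ℂ)) *
          ((ξ : ℂ) ^ n * Complex.exp (-(ξ : ℂ) ^ 2))) := by
      intro n
      refine (integrable_gaussMonomial n).bdd_mul (c := 1) (by fun_prop)
        (Filter.Eventually.of_forall fun ξ => ?_)
      rw [mul_comm, Complex.norm_exp_ofReal_mul_I]
    simp only [← hP]
    simp only [← integral_mul_const, ← integral_const_mul]
    rw [← integral_finsetSum]
    · congr 1
      ext ξ
      rw [mul_assoc, hQ, Polynomial.eval_eq_sum_range'
        (lt_of_le_of_lt Polynomial.natDegree_map_le (Nat.lt_succ_self Q.natDegree))]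
      simp only [Finset.sum_mul, Finset.mul_sum, Polynomial.coeff_map,
        Polynomial.coe_evalRingHom]
      refine Finset.sum_congr rfl fun n _ => ?_
      ring
    · intro n _
      exact ((hint n).mul_const _).const_mul _
  simp only [key]
  exact memLp_finsetSum _ fun n _ =>
    (memLp_re_mul_im (memLp_poly_gauss _) (memLp_poly_gauss _)).const_mul _

/-- The special Hermite functions are square integrable. -/
theorem memLp_specialHermite {d : ℕ} (α β : Fin d → ℕ) :
    MemLp (specialHermite α β) 2 := by
  have hprod : ∀ z : Fin d → ℂ, specialHermite α β z
      = (((2 * Real.pi) ^ (-(d : ℝ) / 2) : ℝ) : ℂ) *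
        ∏ j, ∫ ξ : ℝ, Complex.exp (Complex.I * (((z j).re * ξ : ℝ) : ℂ)) *
          (hermiteFunction (α j) (ξ + (z j).im / 2) : ℂ) *
          (hermiteFunction (β j) (ξ - (z j).im / 2) : ℂ) := by
    intro z
    rw [specialHermite, ← integral_fintype_prod_volume_eq_prod (𝕜 := ℂ) (fun j (ξ : ℝ) =>
      Complex.exp (Complex.I * (((z j).re * ξ : ℝ) : ℂ)) *
          (hermiteFunction (α j) (ξ + (z j).im / 2) : ℂ) *
          (hermiteFunction (β j) (ξ - (z j).im / 2) : ℂ))]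
    congr 2
    ext ξ
    simp only [hermiteFunctionPi, Finset.prod_mul_distrib, Complex.ofReal_prod,
      ← Complex.exp_sum, ← Finset.mul_sum, Complex.ofReal_sum]
  rw [funext hprod]
  refine MemLp.const_mul ?_ _
  have h1 := fun j => memLp_specialHermite_one (α j) (β j)
  have hm : AEStronglyMeasurable (fun z : Fin d → ℂ =>
      ∏ j, ∫ ξ : ℝ, Complex.exp (Complex.I * (((z j).re * ξ : ℝ) : ℂ)) *
          (hermiteFunction (α j) (ξ + (z j).im / 2) : ℂ) *
          (hermiteFunction (β j) (ξ - (z j).im / 2) : ℂ)) volume := by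
    refine Finset.aestronglyMeasurable_fun_prod _ fun j _ => ?_
    exact (h1 j).1.comp_quasiMeasurePreserving
      (Measure.quasiMeasurePreserving_eval (μ := fun _ : Fin d => (volume : Measure ℂ)) j)
  rw [memLp_two_iff_integrable_sq_norm hm]
  have := Integrable.fintype_prod (μ := fun _ : Fin d => (volume : Measure ℂ))
    (fun j => (memLp_two_iff_integrable_sq_norm (h1 j).1).1 (h1 j))
  simp only [norm_prod, ← Finset.prod_pow]
  exact this

/-- `Φ_{α,β}` as an element of `L²(ℂ^d)`, with respect to Lebesgue measure on `ℂ^d`. -/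
noncomputable def specialHermiteLp {d : ℕ} (α β : Fin d → ℕ) :
    Lp ℂ 2 (volume : Measure (Fin d → ℂ)) :=
  (memLp_specialHermite α β).toLp (specialHermite α β)

/-- The spectral projection
`P_μ f = ∑_{β : 2|β| + d = μ} ∑_α ⟨f, Φ_{α,β}⟩ Φ_{α,β}`, the series in `α` being summed in
`L²(ℂ^d)`. In Mathlib the inner product is linear in its second argument, so that
`⟪Φ, f⟫_ℂ = ∫ f conj(Φ)`. -/
noncomputable def spectralProjection {d : ℕ} (μ : ℕ)
    (f : Lp ℂ 2 (volume : Measure (Fin d → ℂ))) : Lp ℂ 2 (volume : Measure (Fin d → ℂ)) :=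
  ∑' β : {β : Fin d → ℕ // 2 * (∑ j, β j) + d = μ},
    ∑' α : Fin d → ℕ, ⟪specialHermiteLp α β.1, f⟫_ℂ • specialHermiteLp α β.1

/-- The closed Euclidean ball `{z : |z| ≤ M}` of `ℂ^d`. -/
def euclideanBall (d : ℕ) (M : ℝ) : Set (Fin d → ℂ) :=
  {z | Real.sqrt (∑ j, ‖z j‖ ^ 2) ≤ M}

end TwistedLaplacian

namespace TwistedLaplacian

open Polynomial Filter Topology Set
open scoped ComplexConjugate

/-! The argument reduces the estimate to the mass of a single special Hermite function on a disc in
one complex variable.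

On `ℂ`, the special Hermite function with indices `a`, `b`, evaluated at `√2 s u` with `|u| = 1`, is
a constant times `(conj u)^a u^b` times the real profile `radialProfile a b s`. Hence two of them
with different angular momentum `b - a` are orthogonal on every disc centred at the origin. The
profile `k` solves `s (s k')' = (m² + s⁴ - 2 E s²) k` with `m = a - b` and `E = a + b + 1`. A
normalized solution has mass `O(M / √E)` on a disc of radius `M`, uniformly in `m`. This is
`radial_mass_le`: one monotone quantity bounds `E` times the inner mass by the flux at radius `R`, a
second one, controlled from infinity, bounds that flux by `O(R √E)` up to a derivative, and
averaging over `R` between `M` and `2 M` removes the derivative.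

On `ℂ^d` everything factorizes. At level `μ` the largest coordinate `β j` satisfies `μ ≤ 2 d (β j +
1)`, so the expansion of the projection splits into `d` parts according to such a `j`. On the `j`-th
part the ball is enlarged to the cylinder `|z j| ≤ M`. There the functions of one level stay
orthogonal: the unrestricted coordinates fix all indices but the `j`-th, the level then fixes `β j`,
and angular momentum fixes `α j`. Each part is therefore bounded, through Bessel's inequality, by
the mass of one function in one disc, which is `O(M μ^(-1/2))` (`norm_tsum_inner_smul_le`). -/

/-! ### Radial polynomials, radial profiles and their ladder relations -/

/-- The polynomials `∑ₖ (-1)ᵏ k! (a choose k) (b choose k) X^(a+b-2k)`: the radial parts of the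
complex Hermite polynomials. -/
noncomputable def radialPoly (a : ℕ) : ℕ → ℝ[X]
  | 0 => X ^ a
  | b + 1 => X * radialPoly a b - (a : ℝ[X]) * match a with
    | 0 => 0
    | a + 1 => radialPoly a b

theorem radialPoly_zero_right (a : ℕ) : radialPoly a 0 = X ^ a := by
  cases a <;> rw [radialPoly]

theorem radialPoly_succ_right (a b : ℕ) :
    radialPoly a (b + 1) = X * radialPoly a b - (a : ℝ[X]) * radialPoly (a - 1) b := by
  cases a <;> simp [radialPoly]

theorem radialPoly_succ_left (a b : ℕ) :
    radialPoly (a + 1) b = X * radialPoly a b - (b : ℝ[X]) * radialPoly a (b - 1) := by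
  induction b generalizing a with
  | zero => simp [radialPoly_zero_right, pow_succ']
  | succ b ih =>
    rcases a with _ | a
    · have h1 := radialPoly_succ_right 1 b
      have h2 := radialPoly_succ_right 0 b
      have h3 := ih 0
      rcases b with _ | b
      · simp_all [radialPoly_zero_right]
      · have h4 := radialPoly_succ_right 0 b
        simp only [zero_add, Nat.add_sub_cancel, Nat.cast_zero, zero_mul, sub_zero,
          Nat.sub_self] at *
        push_cast at *
        linear_combination h1 + X * h3 - X * h2 + ((b : ℝ[X]) + 1) * h4
    · have h1 := radialPoly_succ_right (a + 1 + 1) b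
      have h2 := radialPoly_succ_right (a + 1) b
      have h3 := ih (a + 1)
      have h5 := ih a
      rcases b with _ | b
      · simp [radialPoly_zero_right, radialPoly_succ_right]; ring
      · have h4 := radialPoly_succ_right (a + 1) b
        simp only [Nat.add_sub_cancel] at *
        push_cast at *
        linear_combination h1 + X * h3 - X * h2 + ((b : ℝ[X]) + 1) * h4 - ((a : ℝ[X]) + 1) * h5

theorem radialPoly_comm (a b : ℕ) : radialPoly a b = radialPoly b a := by
  induction b generalizing a with
  | zero =>
    rw [radialPoly_zero_right]
    induction a with
    | zero => simp [radialPoly_zero_right]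
    | succ a ih => rw [radialPoly_succ_right]; simp [← ih, pow_succ']
  | succ b ih => rw [radialPoly_succ_right, radialPoly_succ_left, ih, ih]

/-- Both recurrences compute the same polynomial when the two indices are positive; weighting them
by `a` and `b` and subtracting gives the identity. It plays the role of the angular derivative, and
together with the derivative formula it yields the radial equation. -/
theorem natCast_sub_mul_radialPoly (a b : ℕ) :
    ((a : ℝ[X]) - (b : ℝ[X])) * radialPoly a b
      = X * ((a : ℝ[X]) * radialPoly (a - 1) b - (b : ℝ[X]) * radialPoly a (b - 1)) := by
  rcases a with _ | a <;> rcases b with _ | b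
  · simp
  · have := radialPoly_succ_right 0 b
    simp at *; rw [this]; ring
  · have := radialPoly_succ_left a 0
    simp at *; rw [this]; ring
  · have h1 := radialPoly_succ_right (a + 1) b
    have h2 := radialPoly_succ_left a (b + 1)
    simp only [Nat.add_sub_cancel] at *
    push_cast at *
    linear_combination ((a : ℝ[X]) + 1) * h2 - ((b : ℝ[X]) + 1) * h1

theorem derivative_radialPoly (a b : ℕ) :
    derivative (radialPoly a b)
      = (a : ℝ[X]) * radialPoly (a - 1) b + (b : ℝ[X]) * radialPoly a (b - 1) := by
  induction b generalizing a with
  | zero => simp [radialPoly_zero_right, derivative_X_pow]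
  | succ b ih =>
    rw [radialPoly_succ_right]
    simp only [derivative_sub, derivative_mul, derivative_X, derivative_natCast, ih,
      Nat.add_sub_cancel]
    have h1 := radialPoly_succ_right (a - 1) b
    have h2 : (b : ℝ[X]) * radialPoly a b
      = (b : ℝ[X]) * (X * radialPoly a (b - 1) - (a : ℝ[X]) * radialPoly (a - 1) (b - 1)) := by
      rcases b with _ | b
      · simp
      · rw [radialPoly_succ_right]; rfl
    push_cast
    linear_combination (-(a : ℝ[X])) * h1 - h2

/-- The radial profile of the special Hermite functions, up to normalization and scaling. -/
noncomputable def radialProfile (a b : ℕ) (s : ℝ) : ℝ :=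
  (radialPoly a b).eval s * Real.exp (-s ^ 2 / 2)

theorem radialProfile_succ_right (a b : ℕ) (s : ℝ) :
    radialProfile a (b + 1) s = s * radialProfile a b s - a * radialProfile (a - 1) b s := by
  simp only [radialProfile, radialPoly_succ_right, eval_sub, eval_mul, eval_X, eval_natCast]
  ring

theorem radialProfile_succ_left (a b : ℕ) (s : ℝ) :
    radialProfile (a + 1) b s = s * radialProfile a b s - b * radialProfile a (b - 1) s := by
  simp only [radialProfile, radialPoly_succ_left, eval_sub, eval_mul, eval_X, eval_natCast]
  ring

theorem natCast_sub_mul_radialProfile (a b : ℕ) (s : ℝ) :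
    ((a : ℝ) - b) * radialProfile a b s
      = s * (a * radialProfile (a - 1) b s - b * radialProfile a (b - 1) s) := by
  have h := congr_arg (eval s) (natCast_sub_mul_radialPoly a b)
  simp only [eval_sub, eval_mul, eval_X, eval_natCast] at h
  simp only [radialProfile]
  linear_combination Real.exp (-s ^ 2 / 2) * h

theorem hasDerivAt_radialProfile (a b : ℕ) (s : ℝ) :
    HasDerivAt (radialProfile a b) (a * radialProfile (a - 1) b s
      + b * radialProfile a (b - 1) s - s * radialProfile a b s) s := by
  have h1 := (radialPoly a b).hasDerivAt s
  have h2 : HasDerivAt (fun s : ℝ => Real.exp (-s ^ 2 / 2))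
      (Real.exp (-s ^ 2 / 2) * (-s)) s := by
    convert (((hasDerivAt_pow 2 s).fun_neg).div_const 2).exp using 1
    push_cast; ring
  refine (h1.mul h2).congr_deriv ?_
  simp only [radialProfile, derivative_radialPoly, eval_add, eval_mul, eval_natCast]
  ring

theorem continuous_radialProfile (a b : ℕ) : Continuous (radialProfile a b) := by
  have : radialProfile a b = fun s => (radialPoly a b).eval s * Real.exp (-s ^ 2 / 2) := rfl
  rw [this]
  fun_prop

/-! ### Orthogonality and moments of the profiles for the measure `2 s ds` -/

theorem integrable_poly_mul_exp (P : ℝ[X]) {c : ℝ} (hc : 0 < c) :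
    Integrable (fun s : ℝ => P.eval s * Real.exp (-c * s ^ 2)) := by
  simp only [eval_eq_sum_range, Finset.sum_mul, mul_assoc]
  exact integrable_finsetSum _ fun n _ => (integrable_pow_mul_gauss n hc).const_mul _

theorem tendsto_poly_mul_exp (P : ℝ[X]) :
    Tendsto (fun s : ℝ => P.eval s * Real.exp (-s ^ 2)) atTop (𝓝 0) := by
  have h := P.tendsto_div_exp_atTop.norm
  rw [norm_zero] at h
  refine squeeze_zero_norm' ?_ h
  filter_upwards [eventually_ge_atTop 1] with s hs
  rw [norm_mul, norm_div, div_eq_mul_inv, Real.norm_of_nonneg (Real.exp_pos _).le,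
    Real.norm_of_nonneg (Real.exp_pos _).le, ← Real.exp_neg]
  gcongr
  nlinarith

theorem integrable_poly_mul_radialProfile_mul (P : ℝ[X]) (a b c d : ℕ) :
    Integrable (fun s : ℝ => P.eval s * (radialProfile a b s * radialProfile c d s)) := by
  refine (integrable_poly_mul_exp (P * radialPoly a b * radialPoly c d) one_pos).congr
    (Eventually.of_forall fun s => ?_)
  have : Real.exp (-1 * s ^ 2) = Real.exp (-s ^ 2 / 2) * Real.exp (-s ^ 2 / 2) := by
    rw [← Real.exp_add]; ring_nf
  simp only [radialProfile, eval_mul, this]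
  ring

theorem tendsto_poly_mul_radialProfile_mul (P : ℝ[X]) (a b c d : ℕ) :
    Tendsto (fun s : ℝ => P.eval s * (radialProfile a b s * radialProfile c d s)) atTop (𝓝 0) := by
  refine (tendsto_poly_mul_exp (P * radialPoly a b * radialPoly c d)).congr fun s => ?_
  have : Real.exp (-s ^ 2) = Real.exp (-s ^ 2 / 2) * Real.exp (-s ^ 2 / 2) := by
    rw [← Real.exp_add]; ring_nf
  simp only [radialProfile, eval_mul, this]
  ring

/-- The hypothesis `h` says that the profiles `(a + 1, b)` and `(c, d)` have the same angular
momentum; only then do the terms without a ladder operator cancel. -/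
theorem hasDerivAt_mul_radialProfile_mul (a b c d : ℕ) (h : a + 1 + d = c + b) (s : ℝ) :
    HasDerivAt (fun s : ℝ => s * (radialProfile a b s * radialProfile c d s))
      (2 * s * (c * (radialProfile a b s * radialProfile (c - 1) d s)
        - radialProfile (a + 1) b s * radialProfile c d s)) s := by
  have h1 := (hasDerivAt_id s).mul
    ((hasDerivAt_radialProfile a b s).mul (hasDerivAt_radialProfile c d s))
  refine h1.congr_deriv ?_
  have e1 := natCast_sub_mul_radialProfile a b s
  have e2 := natCast_sub_mul_radialProfile c d s
  have e3 := radialProfile_succ_left a b s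
  have h' : (a : ℝ) + 1 + d = c + b := by exact_mod_cast h
  simp only [id, Pi.mul_apply]
  rw [e3]
  linear_combination -radialProfile c d s * e1 + radialProfile a b s * e2 +
     radialProfile a b s * radialProfile c d s * h'

/-- Raising the first index is adjoint to lowering it. The difference of the two integrands is the
derivative of `s` times a product of profiles, which vanishes at `0` through the factor `s` and at
infinity through the Gaussian. -/
theorem integral_radialProfile_succ_mul (a b c d : ℕ) (h : a + 1 + d = c + b) :
    ∫ s in Ioi (0 : ℝ), 2 * s * (radialProfile (a + 1) b s * radialProfile c d s)
      = c * ∫ s in Ioi (0 : ℝ), 2 * s * (radialProfile a b s * radialProfile (c - 1) d s) := by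
  have i1 := (integrable_poly_mul_radialProfile_mul (2 * X) (a + 1) b c d).integrableOn (s := Ioi 0)
  have i2 := ((integrable_poly_mul_radialProfile_mul (2 * X) a b (c - 1) d).const_mul
    (c : ℝ)).integrableOn (s := Ioi 0)
  have ht := tendsto_poly_mul_radialProfile_mul X a b c d
  simp only [eval_mul, eval_X, eval_ofNat] at i1 i2 ht
  have h1 := integral_Ioi_of_hasDerivAt_of_tendsto' (a := 0)
    (fun s _ => hasDerivAt_mul_radialProfile_mul a b c d h s)
    ((i2.sub i1).congr (Eventually.of_forall fun s => by simp only [Pi.sub_apply]; ring)) ht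
  rw [← integral_const_mul, eq_comm, ← sub_eq_zero, ← integral_sub i2 i1]
  simp only [zero_mul, sub_zero] at h1
  refine Eq.trans ?_ h1
  congr 1
  ext s
  ring

/-- Adjointness lowers both first indices together until one is `0`. If the other is still positive,
one more application produces the factor `0`; if both vanish, `h` forces `b = d`, and symmetry of
the profile reduces the norm to the same recursion. -/
theorem integral_radialProfile_mul (a b c d : ℕ) (h : a + d = c + b) :
    ∫ s in Ioi (0 : ℝ), 2 * s * (radialProfile a b s * radialProfile c d s)
      = if a = c ∧ b = d then (a.factorial : ℝ) * b.factorial else 0 := by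
  have h0 : ∀ b, ∫ s in Ioi (0 : ℝ), 2 * s * (radialProfile 0 b s * radialProfile 0 b s)
      = (b.factorial : ℝ) := by
    intro b
    have hc : ∀ a, radialProfile 0 a = radialProfile a 0 := fun a => by
      ext s; rw [radialProfile, radialPoly_comm]; rfl
    rw [hc]
    induction b with
    | zero =>
      have := integral_Ioi_of_hasDerivAt_of_tendsto' (a := 0) (f := fun s : ℝ => -Real.exp (-s ^ 2))
        (f' := fun s => 2 * s * (radialProfile 0 0 s * radialProfile 0 0 s)) (m := 0) ?_ ?_ ?_
      · simpa using this
      · intro s _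
        have h2 := ((hasDerivAt_pow 2 s).fun_neg).exp.fun_neg
        convert h2 using 1
        have : Real.exp (-s ^ 2) = Real.exp (-s ^ 2 / 2) * Real.exp (-s ^ 2 / 2) := by
          rw [← Real.exp_add]; ring_nf
        simp only [radialProfile, radialPoly_zero_right, this]
        simp; ring
      · have i1 := (integrable_poly_mul_radialProfile_mul (2 * X) 0 0 0 0).integrableOn (s := Ioi 0)
        simp only [eval_mul, eval_X, eval_ofNat] at i1
        exact i1
      · simpa using (tendsto_poly_mul_exp 1).neg
    | succ b ih =>
      rw [integral_radialProfile_succ_mul _ _ _ _ rfl, Nat.add_sub_cancel, ih, Nat.factorial_succ]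
      push_cast; rfl
  induction a generalizing c with
  | zero =>
    rcases c with _ | c
    · obtain rfl : b = d := by omega
      simp [h0]
    · simp only [mul_comm (radialProfile 0 b _)]
      rw [integral_radialProfile_succ_mul _ _ _ _ (by omega)]
      simp
  | succ a ih =>
    rw [integral_radialProfile_succ_mul _ _ _ _ h]
    rcases c with _ | c
    · simp
    · rw [Nat.add_sub_cancel, ih c (by omega)]
      by_cases h1 : a = c ∧ b = d
      · obtain ⟨rfl, rfl⟩ := h1
        simp [Nat.factorial_succ, mul_assoc]
      · simp [h1]

/-- The recurrence writes `s` times the profile `(a, b)` as a combination of `(a, b + 1)` and `(a -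
1, b)`, which have equal angular momentum and are orthogonal, so the squared norms add up. For `a =
0` the second coefficient vanishes and the truncated index is harmless. -/
theorem integral_pow_three_mul_radialProfile_sq (a b : ℕ) :
    ∫ s in Ioi (0 : ℝ), 2 * s ^ 3 * radialProfile a b s ^ 2
      = (a + b + 1 : ℝ) * (a.factorial * b.factorial) := by
  have i1 := (integrable_poly_mul_radialProfile_mul (2 * X)
    a (b + 1) a (b + 1)).integrableOn (s := Ioi 0)
  have i2 := ((integrable_poly_mul_radialProfile_mul (2 * X)
    a (b + 1) (a - 1) b).integrableOn (s := Ioi 0)).const_mul (2 * a : ℝ)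
  have i3 := ((integrable_poly_mul_radialProfile_mul (2 * X)
    (a - 1) b (a - 1) b).integrableOn (s := Ioi 0)).const_mul (a ^ 2 : ℝ)
  simp only [eval_mul, eval_X, eval_ofNat] at i1 i2 i3
  have : ∀ s : ℝ, 2 * s ^ 3 * radialProfile a b s ^ 2
      = 2 * s * (radialProfile a (b + 1) s * radialProfile a (b + 1) s)
        + (2 * a) * (2 * s * (radialProfile a (b + 1) s * radialProfile (a - 1) b s))
        + a ^ 2 * (2 * s * (radialProfile (a - 1) b s * radialProfile (a - 1) b s)) := by
    intro s
    rw [radialProfile_succ_right]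
    ring
  simp only [this]
  rw [integral_add (by exact i1.add i2) i3, integral_add i1 i2, integral_const_mul, integral_const_mul,
    integral_radialProfile_mul _ _ _ _ rfl, integral_radialProfile_mul _ _ _ _ rfl]
  rcases a with _ | a
  · simp [Nat.factorial_succ]
  · rw [integral_radialProfile_mul _ _ _ _ (by omega)]
    simp [Nat.factorial_succ]; ring

/-! ### Mass near the origin of solutions of the radial eigenvalue equation -/

section Virial

variable {k p : ℝ → ℝ} {E m A : ℝ}

/-- An upper bound for the flux `p² - W k²`, where `s k' = p` and `s p' = W k` with
`W = m² + s⁴ - 2 E s²`. -/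
theorem energy_mul_integral_le (hkc : Continuous k) (hpc : Continuous p)
    (hk : ∀ s, 0 < s → HasDerivAt k (p s / s) s)
    (hp : ∀ s, 0 < s → HasDerivAt p ((m ^ 2 + s ^ 4 - 2 * E * s ^ 2) * k s / s) s)
    {R : ℝ} (hR : 0 ≤ R) (hRE : 2 * R ^ 2 ≤ E) :
    E * ∫ s in 0..R, 2 * s * k s ^ 2
      ≤ p R ^ 2 - (m ^ 2 + R ^ 4 - 2 * E * R ^ 2) * k R ^ 2 - (p 0 ^ 2 - m ^ 2 * k 0 ^ 2) := by
  have h := intervalIntegral.integral_eq_sub_of_hasDerivAt_of_le hR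
    (f := fun s => p s ^ 2 - (m ^ 2 + s ^ 4 - 2 * E * s ^ 2) * k s ^ 2)
    (f' := fun s => (4 * E * s - 4 * s ^ 3) * k s ^ 2) (by fun_prop) (fun s hs => by
      have h1 := ((hp s hs.1).fun_pow 2).fun_sub
        (((((hasDerivAt_pow 4 s).const_add (m ^ 2))).fun_sub
          ((hasDerivAt_pow 2 s).const_mul (2 * E))).fun_mul ((hk s hs.1).fun_pow 2))
      refine h1.congr_deriv ?_
      have := hs.1.ne'
      push_cast
      field_simp
      ring)
    (Continuous.intervalIntegrable (by fun_prop) _ _)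
  -- The flux has derivative `-W' k²`, and for `s ≥ 0` the bound `2 s² ≤ E` gives `4 E s - 4 s³ ≥ 2
  -- E s`.
  have h2 : E * ∫ s in 0..R, 2 * s * k s ^ 2 ≤ ∫ s in 0..R, (4 * E * s - 4 * s ^ 3) * k s ^ 2 := by
    rw [← intervalIntegral.integral_const_mul]
    refine intervalIntegral.integral_mono_on hR (Continuous.intervalIntegrable (by fun_prop) _ _)
      (Continuous.intervalIntegrable (by fun_prop) _ _) fun s hs => ?_
    have h3 : 2 * s ^ 2 ≤ E := le_trans (by gcongr; exacts [hs.1, hs.2]) hRE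
    nlinarith [mul_nonneg (mul_nonneg hs.1 (sub_nonneg.2 h3)) (sq_nonneg (k s))]
  rw [h] at h2
  simpa using h2

/-- The Liouville substitution `v = √s k` turns the equation into `v'' = Q v` with `Q = (m² - 1/4) /
s² + s² - 2 E`. The left side divided by `R` is the energy `v'² - Q v²`, whose derivative is `-Q'
v²`. The energy vanishes at infinity, so it equals the integral of `Q' v²` over `[R, ∞)`; the term
with `m²` has a favourable sign, and the rest is controlled by the two moments. -/
theorem radial_energy_le (hE : 1 ≤ E) (hkc : Continuous k)
    (hk : ∀ s, 0 < s → HasDerivAt k (p s / s) s)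
    (hp : ∀ s, 0 < s → HasDerivAt p ((m ^ 2 + s ^ 4 - 2 * E * s ^ 2) * k s / s) s)
    (hi1 : IntegrableOn (fun s => 2 * s * k s ^ 2) (Ioi 0))
    (hi3 : IntegrableOn (fun s => 2 * s ^ 3 * k s ^ 2) (Ioi 0))
    (hA : ∫ s in Ioi 0, 2 * s * k s ^ 2 ≤ A) (hB : ∫ s in Ioi 0, 2 * s ^ 3 * k s ^ 2 ≤ E * A)
    (hlim : Tendsto (fun s => p s ^ 2 + p s * k s + k s ^ 2 / 2
      + (2 * E * s ^ 2 - m ^ 2 - s ^ 4) * k s ^ 2) atTop (𝓝 0))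
    {R : ℝ} (hR : 1 ≤ 2 * R ^ 2) (hR0 : 0 < R) :
    p R ^ 2 + p R * k R + k R ^ 2 / 2 + (2 * E * R ^ 2 - m ^ 2 - R ^ 4) * k R ^ 2
      ≤ R * ((Real.sqrt E + 1) * A) := by
  set Y : ℝ → ℝ := fun s => p s ^ 2 + p s * k s + k s ^ 2 / 2
      + (2 * E * s ^ 2 - m ^ 2 - s ^ 4) * k s ^ 2 with hY
  have hq : 0 < Real.sqrt E := Real.sqrt_pos.2 (by linarith)
  have hqq : Real.sqrt E * Real.sqrt E = E := Real.mul_self_sqrt (by linarith)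
  have hlim' : Tendsto (fun T => Y T / T) atTop (𝓝 0) := by
    simpa [div_eq_mul_inv] using hlim.mul tendsto_inv_atTop_zero
  have hder : ∀ s, 0 < s → HasDerivAt (fun s => Y s / s)
      ((2 * m ^ 2 - 1 / 2 - 2 * s ^ 4) * k s ^ 2 / s ^ 2) s := by
    intro s hs
    have h1 := (((((hp s hs).fun_pow 2).fun_add ((hp s hs).fun_mul (hk s hs))).fun_add
      (((hk s hs).fun_pow 2).div_const 2)).fun_add
      (((((hasDerivAt_pow 2 s).const_mul (2 * E)).sub_const (m ^ 2)).fun_sub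
        (hasDerivAt_pow 4 s)).fun_mul ((hk s hs).fun_pow 2))).fun_div (hasDerivAt_id s) hs.ne'
    refine h1.congr_deriv ?_
    have := hs.ne'
    simp only [id]
    push_cast
    field_simp
    ring
  -- The density `2 s² k²` lies between the two available moments; the weighted inequality `2 s² ≤
  -- √E s + s³ / √E` splits it so that each moment contributes `√E A / 2`. The extra `1` absorbs the
  -- term `1/2` of the derivative, using `1 ≤ 2 s²`.
  set g : ℝ → ℝ := fun s => (Real.sqrt E / 2 + 1) * (2 * s * k s ^ 2)
    + (2 * Real.sqrt E)⁻¹ * (2 * s ^ 3 * k s ^ 2) with hg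
  have hgi : IntegrableOn g (Ioi 0) := (hi1.const_mul _).add (hi3.const_mul _)
  have hgA : ∫ s in Ioi 0, g s ≤ (Real.sqrt E + 1) * A := by
    rw [hg, integral_add (hi1.const_mul _) (hi3.const_mul _), integral_const_mul,
      integral_const_mul]
    have : (2 * Real.sqrt E)⁻¹ * (E * A) = Real.sqrt E / 2 * A := by
      rw [← hqq]
      field_simp
      rw [Real.sqrt_sq hq.le]
    calc _ ≤ (Real.sqrt E / 2 + 1) * A + (2 * Real.sqrt E)⁻¹ * (E * A) := by gcongr
      _ = _ := by rw [this]; ring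
  have hgc : Continuous g := by fun_prop
  have key : ∀ T, R ≤ T → Y R / R ≤ Y T / T + (Real.sqrt E + 1) * A := by
    intro T hT
    have h := intervalIntegral.integral_eq_sub_of_hasDerivAt_of_le hT
      (fun s hs => (hder s (hR0.trans_le hs.1)).continuousAt.continuousWithinAt)
      (fun s hs => hder s (hR0.trans hs.1)) (by
        refine ContinuousOn.intervalIntegrable ?_
        rw [uIcc_of_le hT]
        refine ContinuousOn.div (by fun_prop) (by fun_prop) fun s hs => ?_
        exact pow_ne_zero 2 (hR0.trans_le hs.1).ne')
    have h2 : ∫ s in R..T, -((2 * m ^ 2 - 1 / 2 - 2 * s ^ 4) * k s ^ 2 / s ^ 2)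
        ≤ ∫ s in R..T, g s := by
      refine intervalIntegral.integral_mono_on hT ?_ (hgc.intervalIntegrable _ _) fun s hs => ?_
      · refine ContinuousOn.intervalIntegrable ?_
        rw [uIcc_of_le hT]
        refine (ContinuousOn.div (by fun_prop) (by fun_prop) fun s hs => ?_).neg
        exact pow_ne_zero 2 (hR0.trans_le hs.1).ne'
      · have hs0 : 0 < s := hR0.trans_le hs.1
        have hs1 : 1 ≤ 2 * s ^ 2 := hR.trans (by gcongr; exact hs.1)
        have hs2 : 1 ≤ 2 * s := by nlinarith
        have h4 : (1 / 2 + 2 * s ^ 4 - 2 * m ^ 2) / s ^ 2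
            ≤ (Real.sqrt E / 2 + 1) * (2 * s) + (2 * Real.sqrt E)⁻¹ * (2 * s ^ 3) := by
          have e1 : (1 / 2 + 2 * s ^ 4 - 2 * m ^ 2) / s ^ 2 ≤ 2 * s + 2 * s ^ 2 := by
            rw [div_le_iff₀ (by positivity)]
            nlinarith [sq_nonneg m, mul_le_mul hs1 hs2 (by norm_num) (by positivity)]
          have e2 : 2 * s ^ 2 ≤ Real.sqrt E * s + (Real.sqrt E)⁻¹ * s ^ 3 := by
            have : Real.sqrt E * s + (Real.sqrt E)⁻¹ * s ^ 3 - 2 * s ^ 2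
                = (Real.sqrt E)⁻¹ * s * (Real.sqrt E - s) ^ 2 := by
              field_simp; ring
            have : 0 ≤ (Real.sqrt E)⁻¹ * s * (Real.sqrt E - s) ^ 2 := by positivity
            linarith
          rw [mul_inv]
          linarith
        have := mul_le_mul_of_nonneg_right h4 (sq_nonneg (k s))
        simp only [hg]
        refine le_trans (le_of_eq ?_) (this.trans (le_of_eq ?_)) <;> ring
    have h3 : ∫ s in R..T, g s ≤ ∫ s in Ioi 0, g s := by
      rw [intervalIntegral.integral_of_le hT]
      refine setIntegral_mono_set hgi ?_ ?_
      · filter_upwards [ae_restrict_mem measurableSet_Ioi] with s hs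
        have : 0 < s := hs
        simp only [hg, Pi.zero_apply]
        positivity
      · exact (Ioc_subset_Ioi_self.trans (Ioi_subset_Ioi hR0.le)).eventuallyLE
    rw [intervalIntegral.integral_neg, h] at h2
    linarith
  have hfin : Y R / R ≤ 0 + (Real.sqrt E + 1) * A :=
    ge_of_tendsto (hlim'.add_const _) ((eventually_ge_atTop R).mono key)
  rw [zero_add, div_le_iff₀ hR0] at hfin
  rw [mul_comm R]
  exact hfin

/-- A solution of the radial eigenvalue equation `s (s k')' = (m² + s⁴ - 2 E s²) k` carries at most
a fraction `O(M / √E)` of its mass on `[0, M]`. -/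
theorem radial_mass_le (hE : 1 ≤ E) (hkc : Continuous k) (hpc : Continuous p)
    (hp0 : p 0 = 0) (hk0 : m * k 0 = 0)
    (hk : ∀ s, 0 < s → HasDerivAt k (p s / s) s)
    (hp : ∀ s, 0 < s → HasDerivAt p ((m ^ 2 + s ^ 4 - 2 * E * s ^ 2) * k s / s) s)
    (hi1 : IntegrableOn (fun s => 2 * s * k s ^ 2) (Ioi 0))
    (hi3 : IntegrableOn (fun s => 2 * s ^ 3 * k s ^ 2) (Ioi 0))
    (hA : ∫ s in Ioi 0, 2 * s * k s ^ 2 ≤ A) (hB : ∫ s in Ioi 0, 2 * s ^ 3 * k s ^ 2 ≤ E * A)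
    (hlim : Tendsto (fun s => p s ^ 2 + p s * k s + k s ^ 2 / 2
      + (2 * E * s ^ 2 - m ^ 2 - s ^ 4) * k s ^ 2) atTop (𝓝 0))
    {M : ℝ} (hM : 1 ≤ 2 * M ^ 2) (hM0 : 0 < M) :
    ∫ s in Ioc 0 M, 2 * s * k s ^ 2 ≤ 6 * M / Real.sqrt E * A := by
  have hq : 1 ≤ Real.sqrt E := Real.one_le_sqrt.2 hE
  have hqq : Real.sqrt E * Real.sqrt E = E := Real.mul_self_sqrt (by linarith)
  have hpos : ∀ s, 0 < s → 0 ≤ 2 * s * k s ^ 2 := fun s hs => by positivity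
  have hsub : ∀ a b, 0 ≤ a → ∫ s in Ioc a b, 2 * s * k s ^ 2 ≤ A := fun a b ha => by
    refine (setIntegral_mono_set hi1 ?_ ?_).trans hA
    · filter_upwards [ae_restrict_mem measurableSet_Ioi] with s hs using hpos s hs
    · exact (Ioc_subset_Ioi_self.trans (Ioi_subset_Ioi ha)).eventuallyLE
  have hA0 : 0 ≤ A := le_trans (by simp) (hsub 0 0 le_rfl)
  -- The flux bound is needed up to radius `2 M`. If this fails then `E < 8 M²`, so `6 M / √E ≥ 1`
  -- and the trivial bound by the total mass suffices.
  by_cases hME : 2 * (2 * M) ^ 2 ≤ E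
  · set N := ∫ s in 0..M, 2 * s * k s ^ 2 with hN
    set S := (Real.sqrt E + 1) * A with hS
    -- The flux and the Liouville energy differ by `p k + k² / 2`, which has no sign but is half the
    -- derivative of `R k²`.
    have hbound : ∀ R ∈ Icc M (2 * M), E * N ≤ 2 * M * S - p R * k R - k R ^ 2 / 2 := by
      intro R hR
      have hR0 : 0 < R := hM0.trans_le hR.1
      have h1 := energy_mul_integral_le hkc hpc hk hp hR0.le
        (le_trans (by gcongr; exact hR.2) hME)
      have h2 := radial_energy_le hE hkc hk hp hi1 hi3 hA hB hlim
        (hM.trans (by gcongr; exact hR.1)) hR0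
      have h3 : N ≤ ∫ s in 0..R, 2 * s * k s ^ 2 := by
        refine intervalIntegral.integral_mono_interval le_rfl hM0.le hR.1 ?_
          (Continuous.intervalIntegrable (by fun_prop) _ _)
        filter_upwards [ae_restrict_mem measurableSet_Ioc] with s hs using hpos s hs.1
      have h4 : m ^ 2 * k 0 ^ 2 = 0 := by rw [← mul_pow, hk0]; simp
      have h5 : E * N ≤ E * ∫ s in 0..R, 2 * s * k s ^ 2 := by gcongr
      have h6 : R * S ≤ 2 * M * S := by
        have : 0 ≤ S := by positivity
        gcongr
        exact hR.2
      rw [hp0, h4] at h1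
      linarith
    -- Averaging with the weight `R - M` kills the boundary term at `M` and leaves a nonnegative one
    -- at `2 M`; the derivative of the weight costs only `R k² / 2`, whose integral is at most `A /
    -- 4`.
    have hFTC := intervalIntegral.integral_eq_sub_of_hasDerivAt_of_le (a := M) (b := 2 * M)
      (by linarith) (f := fun R => (R - M) * (R * k R ^ 2) / 2)
      (f' := fun R => R * k R ^ 2 / 2 + (R - M) * (p R * k R + k R ^ 2 / 2)) (by fun_prop)
      (fun R hR => by
        have hR0 : 0 < R := hM0.trans hR.1
        have h1 := (((hasDerivAt_id R).sub_const M).fun_mul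
          ((hasDerivAt_id R).fun_mul ((hk R hR0).fun_pow 2))).div_const 2
        refine h1.congr_deriv ?_
        have := hR0.ne'
        simp only [id]
        push_cast
        field_simp
        ring)
      (Continuous.intervalIntegrable (by fun_prop) _ _)
    have hle : ∫ R in M..(2 * M), (R * k R ^ 2 / 2 + (R - M) * (p R * k R + k R ^ 2 / 2))
        ≤ ∫ R in M..(2 * M), (1 / 4 * (2 * R * k R ^ 2) + (R - M) * (2 * M * S - E * N)) := by
      refine intervalIntegral.integral_mono_on (by linarith)
        (Continuous.intervalIntegrable (by fun_prop) _ _)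
        (Continuous.intervalIntegrable (by fun_prop) _ _) fun R hR => ?_
      have := mul_le_mul_of_nonneg_left (hbound R hR) (sub_nonneg.2 hR.1)
      linarith
    rw [hFTC, intervalIntegral.integral_add (Continuous.intervalIntegrable (by fun_prop) _ _)
      (Continuous.intervalIntegrable (by fun_prop) _ _), intervalIntegral.integral_const_mul,
      intervalIntegral.integral_mul_const, intervalIntegral.integral_of_le (by linarith),
      intervalIntegral.integral_sub (Continuous.intervalIntegrable (by fun_prop) _ _)
      (Continuous.intervalIntegrable (by fun_prop) _ _), integral_id,
      intervalIntegral.integral_const, smul_eq_mul] at hle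
    have h7 := hsub M (2 * M) hM0.le
    have h8 : 0 ≤ (2 * M - M) * (2 * M * k (2 * M) ^ 2) / 2 := by
      have : 0 ≤ 2 * M - M := by linarith
      positivity
    have h9 : 0 ≤ A / 4 + M ^ 2 / 2 * (2 * M * S - E * N) := by linarith
    -- Dividing by `M² / 2` leaves `A / (2 M²)`, which is at most `A` because `1 ≤ 2 M²`.
    have h10 : E * N ≤ 2 * M * S + A := by
      by_contra hcon
      push Not at hcon
      nlinarith
    rw [← intervalIntegral.integral_of_le hM0.le, ← hN]
    have hM1 : 1 ≤ 2 * M := by nlinarith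
    have h11 : E * N ≤ 6 * M * Real.sqrt E * A := by
      refine h10.trans ?_
      have : 2 * M * (Real.sqrt E + 1) + 1 ≤ 6 * M * Real.sqrt E := by nlinarith
      nlinarith
    have hq0 : 0 < Real.sqrt E := by linarith
    rw [div_mul_eq_mul_div, le_div_iff₀ hq0]
    refine le_of_mul_le_mul_right ?_ hq0
    rw [mul_assoc, hqq]
    linarith
  · refine (hsub 0 M le_rfl).trans (le_mul_of_one_le_left hA0 ?_)
    rw [le_div_iff₀ (by linarith), one_mul]
    refine Real.sqrt_le_iff.2 ⟨by linarith, ?_⟩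
    nlinarith

end Virial

/-- The mass of the radial profile on `[0, M]`. -/
theorem integral_radialProfile_sq_le (a b : ℕ) {M : ℝ} (hM : 1 ≤ 2 * M ^ 2) (hM0 : 0 < M) :
    ∫ s in Ioc 0 M, 2 * s * radialProfile a b s ^ 2
      ≤ 6 * M / Real.sqrt (a + b + 1) * (a.factorial * b.factorial) := by
  set k := radialProfile a b
  set k' : ℝ → ℝ := fun s => a * radialProfile (a - 1) b s
      + b * radialProfile a (b - 1) s - s * radialProfile a b s
  have hc := continuous_radialProfile
  have e1 := natCast_sub_mul_radialProfile a b
  have i1 := (integrable_poly_mul_radialProfile_mul (2 * X) a b a b).integrableOn (s := Ioi 0)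
  have i3 := (integrable_poly_mul_radialProfile_mul (2 * X ^ 3) a b a b).integrableOn (s := Ioi 0)
  simp only [eval_mul, eval_pow, eval_X, eval_ofNat, ← pow_two] at i1 i3
  -- Here `E = a + b + 1`. The condition `m * k 0 = 0` comes from `e1`, whose right side carries a
  -- factor `s`.
  refine radial_mass_le (k := k) (p := fun s => s * k' s) (m := (a : ℝ) - b)
    (le_add_of_nonneg_left (by positivity)) (hc a b) (by fun_prop) (by simp) (by simp [k, e1]) ?_ ?_
    i1 i3 ?_ (integral_pow_three_mul_radialProfile_sq a b).le ?_ hM hM0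
  · intro s hs
    refine (hasDerivAt_radialProfile a b s).congr_deriv ?_
    field_simp
    rfl
  · intro s hs
    -- Eliminating the profile `(a - 1, b)` by `e1` leaves only `(a, b - 1)` and `(a, b)`, a pair
    -- closed under differentiation by `hκ`.
    have hpe : (fun s => s * k' s) = fun s => b * (2 * s * radialProfile a (b - 1) s)
        + (a - b - s ^ 2) * k s := by
      ext s
      simp only [k', k]
      linear_combination -e1 s
    have hκ : (b : ℝ) * (s * (a * radialProfile (a - 1) (b - 1) s
        + (b - 1 : ℕ) * radialProfile a (b - 1 - 1) s - s * radialProfile a (b - 1) s))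
        = b * ((s ^ 2 - (a - b) - 1) * radialProfile a (b - 1) s - 2 * s * k s) := by
      rcases b with _ | b
      · simp
      · have h1 := natCast_sub_mul_radialProfile a b s
        have h2 := radialProfile_succ_right a b s
        simp only [Nat.add_sub_cancel, k, h2]
        push_cast
        linear_combination ((b : ℝ) + 1) * h1
    rw [hpe]
    have h1 := ((((hasDerivAt_id s).const_mul 2).fun_mul
      (hasDerivAt_radialProfile a (b - 1) s)).const_mul (b : ℝ)).fun_add
      (((hasDerivAt_pow 2 s).const_sub ((a : ℝ) - b)).fun_mul (hasDerivAt_radialProfile a b s))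
    refine h1.congr_deriv ?_
    rw [eq_div_iff hs.ne']
    simp only [id, k] at *
    push_cast
    linear_combination 2 * s * hκ - (a - b - s ^ 2) * e1 s
  · have := integral_radialProfile_mul a b a b rfl
    simp only [and_self, if_true] at this
    simp only [pow_two]
    exact this.le
  · set Q := radialPoly a b
    set P : ℝ[X] := X * ((a : ℝ[X]) * radialPoly (a - 1) b + (b : ℝ[X]) * radialPoly a (b - 1)
      - X * radialPoly a b)
    refine (tendsto_poly_mul_exp (P ^ 2 + P * Q + C (1 / 2) * Q ^ 2
      + (C (2 * ((a : ℝ) + b + 1)) * X ^ 2 - C (((a : ℝ) - b) ^ 2) - X ^ 4) * Q ^ 2)).congr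
      fun s => ?_
    have : Real.exp (-s ^ 2) = Real.exp (-s ^ 2 / 2) * Real.exp (-s ^ 2 / 2) := by
      rw [← Real.exp_add]; ring_nf
    simp only [k', k, radialProfile, P, Q, eval_add, eval_sub, eval_mul, eval_pow, eval_X, eval_C,
      eval_natCast, this]
    ring

/-! ### Fourier–Wigner transforms of Hermite functions in one complex variable -/

theorem derivative_hermite (n : ℕ) :
    derivative (hermite n) = (n : ℤ[X]) * hermite (n - 1) := by
  induction n with
  | zero => simp [hermite_zero]
  | succ n ih =>
    have h : (n : ℤ[X]) * hermite n
        = (n : ℤ[X]) * (X * hermite (n - 1) - derivative (hermite (n - 1))) := by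
      rcases n with _ | n
      · simp
      · rw [hermite_succ]; rfl
    rw [hermite_succ]
    simp only [derivative_sub, derivative_mul, derivative_X, ih, derivative_natCast,
      Nat.add_sub_cancel]
    push_cast
    linear_combination -h

/-- The Hermite function without its normalizing factor. -/
noncomputable def hermiteGauss (n : ℕ) (t : ℝ) : ℝ :=
  aeval (Real.sqrt 2 * t) (hermite n) * Real.exp (-t ^ 2 / 2)

theorem hermiteFunction_eq (n : ℕ) (t : ℝ) :
    hermiteFunction n t = (Real.sqrt (n.factorial * Real.sqrt Real.pi))⁻¹ * hermiteGauss n t := by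
  rw [hermiteFunction, hermiteGauss]
  ring

theorem hermiteGauss_succ (n : ℕ) (t : ℝ) :
    hermiteGauss (n + 1) t = Real.sqrt 2 * t * hermiteGauss n t - n * hermiteGauss (n - 1) t := by
  rw [hermiteGauss, hermite_succ, derivative_hermite]
  simp only [hermiteGauss, map_sub, map_mul, aeval_X, map_natCast]
  ring

theorem hasDerivAt_hermiteGauss (n : ℕ) (t : ℝ) :
    HasDerivAt (hermiteGauss n)
      (Real.sqrt 2 * n * hermiteGauss (n - 1) t - t * hermiteGauss n t) t := by
  have h1 : HasDerivAt (fun t : ℝ => aeval (Real.sqrt 2 * t) (hermite n))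
      (aeval (Real.sqrt 2 * t) (derivative (hermite n)) * Real.sqrt 2) t := by
    have := ((hermite n).hasDerivAt_aeval (Real.sqrt 2 * t)).comp t
      ((hasDerivAt_id t).const_mul (Real.sqrt 2))
    rw [mul_one] at this
    exact this
  have h2 : HasDerivAt (fun s : ℝ => Real.exp (-s ^ 2 / 2))
      (Real.exp (-t ^ 2 / 2) * (-t)) t := by
    convert (((hasDerivAt_pow 2 t).fun_neg).div_const 2).exp using 1
    push_cast; ring
  refine (h1.mul h2).congr_deriv ?_
  simp only [hermiteGauss, derivative_hermite, map_mul, map_natCast]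
  ring

theorem memLp_hermiteGauss (n : ℕ) : MemLp (fun t => (hermiteGauss n t : ℂ)) 2 := by
  have hc : Continuous (hermiteGauss n) :=
    continuous_iff_continuousAt.2 fun t => (hasDerivAt_hermiteGauss n t).continuousAt
  have hc' : Continuous fun t => (hermiteGauss n t : ℂ) := by fun_prop
  rw [memLp_two_iff_integrable_sq_norm hc'.aestronglyMeasurable]
  refine (integrable_poly_mul_exp
    ((((hermite n).map (Int.castRingHom ℝ)).comp (C (Real.sqrt 2) * X)) ^ 2) one_pos).congr
    (Eventually.of_forall fun s => ?_)
  have : Real.exp (-1 * s ^ 2) = Real.exp (-s ^ 2 / 2) ^ 2 := by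
    rw [pow_two (Real.exp _), ← Real.exp_add]; ring_nf
  have h2 : eval s (((hermite n).map (Int.castRingHom ℝ)).comp (C (Real.sqrt 2) * X))
      = aeval (Real.sqrt 2 * s) (hermite n) := by
    simp [eval_comp, aeval_def, eval_map]
  simp only [eval_pow, h2, this, Complex.norm_real, Real.norm_eq_abs, sq_abs, hermiteGauss]
  ring

/-- The integrand of the one-dimensional Fourier–Wigner transform of two Hermite functions. -/
noncomputable def wignerIntegrand (a b : ℕ) (z : ℂ) (ξ : ℝ) : ℂ :=
  Complex.exp (Complex.I * ((z.re * ξ : ℝ) : ℂ)) *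
    (hermiteGauss a (ξ + z.im / 2) : ℂ) * (hermiteGauss b (ξ - z.im / 2) : ℂ)

/-- The one-dimensional Fourier–Wigner transform of two unnormalized Hermite functions. -/
noncomputable def hermiteWigner (a b : ℕ) (z : ℂ) : ℂ := ∫ ξ, wignerIntegrand a b z ξ

theorem integrable_wignerIntegrand (a b : ℕ) (z : ℂ) : Integrable (wignerIntegrand a b z) := by
  have h1 : MemLp (fun ξ : ℝ => (hermiteGauss a (ξ + z.im / 2) : ℂ)) 2 :=
    (memLp_hermiteGauss a).comp_measurePreserving (measurePreserving_add_right volume (z.im / 2))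
  have h2 : MemLp (fun ξ : ℝ => (hermiteGauss b (ξ - z.im / 2) : ℂ)) 2 :=
    (memLp_hermiteGauss b).comp_measurePreserving (measurePreserving_sub_right volume (z.im / 2))
  have h3 := (MemLp.integrable_mul h1 h2).bdd_mul (c := 1)
    (f := fun ξ : ℝ => Complex.exp (Complex.I * ((z.re * ξ : ℝ) : ℂ))) (by fun_prop)
    (Eventually.of_forall fun ξ => by rw [mul_comm, Complex.norm_exp_ofReal_mul_I])
  refine h3.congr (Eventually.of_forall fun ξ => ?_)
  simp only [wignerIntegrand, Pi.mul_apply, mul_assoc]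

theorem hasDerivAt_wignerIntegrand (a b : ℕ) (z : ℂ) (ξ : ℝ) :
    HasDerivAt (wignerIntegrand a b z)
      (Complex.I * z.re * wignerIntegrand a b z ξ
        + Real.sqrt 2 * a * wignerIntegrand (a - 1) b z ξ
        + Real.sqrt 2 * b * wignerIntegrand a (b - 1) z ξ
        - 2 * ξ * wignerIntegrand a b z ξ) ξ := by
  have h1 : HasDerivAt (fun ξ : ℝ => Complex.exp (Complex.I * ((z.re * ξ : ℝ) : ℂ)))
      (Complex.exp (Complex.I * ((z.re * ξ : ℝ) : ℂ)) * (Complex.I * z.re)) ξ := by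
    have := ((((hasDerivAt_id ξ).const_mul z.re).ofReal_comp).const_mul Complex.I).cexp
    simpa using this
  have h2 := ((hasDerivAt_hermiteGauss a (ξ + z.im / 2)).comp_add_const ξ (z.im / 2)).ofReal_comp
  have h3 := ((hasDerivAt_hermiteGauss b (ξ - z.im / 2)).comp_sub_const ξ (z.im / 2)).ofReal_comp
  refine ((h1.mul h2).mul h3).congr_deriv ?_
  simp only [wignerIntegrand, Pi.mul_apply]
  push_cast
  ring

theorem integral_deriv_wignerIntegrand {F : ℝ → ℂ} (a b : ℕ) (z : ℂ)
    (hF : ∀ ξ, F ξ = Complex.I * z.re * wignerIntegrand a b z ξ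
        + Real.sqrt 2 * a * wignerIntegrand (a - 1) b z ξ
        + Real.sqrt 2 * b * wignerIntegrand a (b - 1) z ξ
        - 2 * ξ * wignerIntegrand a b z ξ) (hi : Integrable F) : ∫ ξ, F ξ = 0 :=
  integral_eq_zero_of_hasDerivAt_of_integrable
    (fun ξ => (hasDerivAt_wignerIntegrand a b z ξ).congr_deriv (hF ξ).symm) hi
    (integrable_wignerIntegrand a b z)

theorem sqrt_two_mul_sqrt_two : (Real.sqrt 2 : ℂ) * Real.sqrt 2 = 2 := by
  rw [← Complex.ofReal_mul, Real.mul_self_sqrt (by norm_num)]; simp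

/-- The `ξ`-derivative of the integrand has integral zero. Writing `2 ξ = 2 (ξ - y/2) + y`, the
Hermite recurrence in `b` absorbs the first part, and `-y` completes `i x` to `i z`. Splitting
around `ξ + y/2` instead gives the recurrence in `a`, with `conj z`. -/
theorem hermiteWigner_succ_right (a b : ℕ) (z : ℂ) :
    Real.sqrt 2 * hermiteWigner a (b + 1) z
      = Complex.I * z * hermiteWigner a b z + Real.sqrt 2 * a * hermiteWigner (a - 1) b z := by
  have hi := integrable_wignerIntegrand
  have i1 := (hi a b z).const_mul (Complex.I * z)
  have i2 := (hi (a - 1) b z).const_mul (Real.sqrt 2 * a)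
  have i3 := (hi a (b + 1) z).const_mul (Real.sqrt 2)
  have h := integral_deriv_wignerIntegrand a b z (F := fun ξ =>
    Complex.I * z * wignerIntegrand a b z ξ + Real.sqrt 2 * a * wignerIntegrand (a - 1) b z ξ
      - Real.sqrt 2 * wignerIntegrand a (b + 1) z ξ) (fun ξ => by
      have hz : Complex.I * z = Complex.I * z.re - z.im := by
        conv_lhs => rw [← Complex.re_add_im z]
        linear_combination (z.im : ℂ) * Complex.I_sq
      rw [hz]
      simp only [wignerIntegrand, hermiteGauss_succ]
      push_cast
      linear_combination -(Complex.exp (Complex.I * (z.re * ξ)) *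
        (hermiteGauss a (ξ + z.im / 2) : ℂ) * (hermiteGauss b (ξ - z.im / 2) : ℂ)) *
        (ξ - z.im / 2) * sqrt_two_mul_sqrt_two)
    ((i1.add i2).sub i3)
  rw [integral_sub (by exact i1.add i2) i3, integral_add i1 i2, integral_const_mul,
    integral_const_mul, integral_const_mul] at h
  exact (sub_eq_zero.1 h).symm

theorem hermiteWigner_succ_left (a b : ℕ) (z : ℂ) :
    Real.sqrt 2 * hermiteWigner (a + 1) b z
      = Complex.I * conj z * hermiteWigner a b z + Real.sqrt 2 * b * hermiteWigner a (b - 1) z := by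
  have hi := integrable_wignerIntegrand
  have i1 := (hi a b z).const_mul (Complex.I * conj z)
  have i2 := (hi a (b - 1) z).const_mul (Real.sqrt 2 * b)
  have i3 := (hi (a + 1) b z).const_mul (Real.sqrt 2)
  have h := integral_deriv_wignerIntegrand a b z (F := fun ξ =>
    Complex.I * conj z * wignerIntegrand a b z ξ + Real.sqrt 2 * b * wignerIntegrand a (b - 1) z ξ
      - Real.sqrt 2 * wignerIntegrand (a + 1) b z ξ) (fun ξ => by
      have hz : Complex.I * conj z = Complex.I * z.re + z.im := by
        conv_lhs => rw [← Complex.re_add_im z]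
        simp only [map_add, map_mul, Complex.conj_ofReal, Complex.conj_I]
        linear_combination -(z.im : ℂ) * Complex.I_sq
      rw [hz]
      simp only [wignerIntegrand, hermiteGauss_succ]
      push_cast
      linear_combination -(Complex.exp (Complex.I * (z.re * ξ)) *
        (hermiteGauss a (ξ + z.im / 2) : ℂ) * (hermiteGauss b (ξ - z.im / 2) : ℂ)) *
        (ξ + z.im / 2) * sqrt_two_mul_sqrt_two)
    ((i1.add i2).sub i3)
  rw [integral_sub (by exact i1.add i2) i3, integral_add i1 i2, integral_const_mul,
    integral_const_mul, integral_const_mul] at h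
  exact (sub_eq_zero.1 h).symm

theorem hermiteWigner_zero_zero (z : ℂ) :
    hermiteWigner 0 0 z = Real.sqrt Real.pi * Complex.exp (-(‖z‖ ^ 2 / 4 : ℝ)) := by
  have h := fourierIntegral_gaussian (b := 1) (by simp) (z.re : ℂ)
  have e : ∀ ξ, wignerIntegrand 0 0 z ξ = (Complex.exp (Complex.I * z.re * ξ) *
      Complex.exp (-1 * (ξ : ℂ) ^ 2)) * Complex.exp (-(z.im : ℂ) ^ 2 / 4) := by
    intro ξ
    simp only [wignerIntegrand, hermiteGauss, hermite_zero, map_one, one_mul]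
    push_cast
    rw [← Complex.exp_add, ← Complex.exp_add, ← Complex.exp_add, ← Complex.exp_add]
    congr 1
    ring
  rw [hermiteWigner]
  simp only [e]
  rw [integral_mul_const, h, div_one, mul_assoc, ← Complex.exp_add, Real.sqrt_eq_rpow,
    Complex.ofReal_cpow Real.pi_pos.le, Complex.sq_norm, Complex.normSq_apply]
  push_cast
  congr 2
  ring

/-- At radius `√2 s` the factors `√2` cancel, and the Wigner and radial recurrences match once the
phases are pulled out; the Gaussian case starts the induction. -/
theorem hermiteWigner_eq_radialProfile (a b : ℕ) (s : ℝ) (u : ℂ) (hu : ‖u‖ = 1) :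
    hermiteWigner a b ((Real.sqrt 2 * s : ℝ) * u)
      = Real.sqrt Real.pi * (Complex.I * conj u) ^ a * (Complex.I * u) ^ b
        * radialProfile a b s := by
  have h0 : (Real.sqrt 2 : ℂ) ≠ 0 := by simp
  have huu : conj u * u = 1 := by
    rw [mul_comm, Complex.mul_conj, Complex.normSq_eq_norm_sq, hu]; simp
  induction b generalizing a with
  | zero =>
    induction a with
    | zero =>
      rw [hermiteWigner_zero_zero, norm_mul, hu, mul_one, Complex.norm_real, Real.norm_eq_abs,
        sq_abs, mul_pow, Real.sq_sqrt (by norm_num)]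
      simp only [pow_zero, mul_one, radialProfile, radialPoly_zero_right, eval_one, one_mul]
      push_cast
      congr 2
      ring
    | succ a ih =>
      have h := hermiteWigner_succ_left a 0 ((Real.sqrt 2 * s : ℝ) * u)
      rw [ih] at h
      refine mul_left_cancel₀ h0 (h.trans ?_)
      rw [radialProfile_succ_left]
      simp only [map_mul, Complex.conj_ofReal]
      push_cast
      ring
  | succ b ih =>
    have h := hermiteWigner_succ_right a b ((Real.sqrt 2 * s : ℝ) * u)
    rw [ih, ih] at h
    refine mul_left_cancel₀ h0 (h.trans ?_)
    rw [radialProfile_succ_right]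
    rcases a with _ | a
    · push_cast
      ring
    · rw [Nat.add_sub_cancel]
      push_cast
      -- This turns the plus sign of the Wigner recurrence into the minus sign of the radial one.
      have hI : (Complex.I * conj u) * (Complex.I * u) = -1 := by
        linear_combination Complex.I ^ 2 * huu + Complex.I_sq
      linear_combination (Real.sqrt 2 * (a + 1) * Real.sqrt Real.pi * (Complex.I * conj u) ^ a *
        (Complex.I * u) ^ b * radialProfile a b s) * hI

/-! ### Orthogonality and mass on discs, in polar coordinates -/

theorem integral_exp_pow_mul_conj_pow (m n : ℕ) :
    ∫ θ in Ioo (-Real.pi) Real.pi, Complex.exp (θ * Complex.I) ^ m *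
        (conj (Complex.exp (θ * Complex.I))) ^ n
      = if m = n then 2 * (Real.pi : ℂ) else 0 := by
  have e : ∀ θ : ℝ, Complex.exp (θ * Complex.I) ^ m * (conj (Complex.exp (θ * Complex.I))) ^ n
      = Complex.exp ((((m : ℂ) - n) * Complex.I) * θ) := by
    intro θ
    rw [← Complex.exp_conj, map_mul, Complex.conj_ofReal, Complex.conj_I, ← Complex.exp_nat_mul,
      ← Complex.exp_nat_mul, ← Complex.exp_add]
    congr 1
    ring
  simp only [e]
  rw [← integral_Ioc_eq_integral_Ioo, ← intervalIntegral.integral_of_le (by linarith [Real.pi_pos])]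
  split_ifs with h
  · subst h
    simp
    ring
  · have hmn : (m : ℂ) - n ≠ 0 := sub_ne_zero.2 (by exact_mod_cast h)
    rw [integral_exp_mul_complex (mul_ne_zero hmn Complex.I_ne_zero)]
    have : Complex.exp (((m : ℂ) - n) * Complex.I * (Real.pi : ℝ))
        = Complex.exp (((m : ℂ) - n) * Complex.I * ((-Real.pi : ℝ) : ℂ)) := by
      rw [Complex.exp_eq_exp_iff_exists_int]
      refine ⟨(m : ℤ) - n, ?_⟩
      push_cast
      ring
    rw [this, sub_self, zero_div]

/-- In polar coordinates the angular factor is `u^(a + d) (conj u)^(b + c)`, independent of the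
radial set `S`. The radius is rescaled by `√2`, which turns `r dr` into `2 s ds`. -/
theorem setIntegral_conj_hermiteWigner_mul (a b c d : ℕ) {S : Set ℝ} (hS : MeasurableSet S) :
    ∫ z in {z : ℂ | ‖z‖ ∈ S}, conj (hermiteWigner a b z) * hermiteWigner c d z
      = Real.pi * ((-Complex.I) ^ (a + b) * Complex.I ^ (c + d)) *
        (if a + d = b + c then 2 * (Real.pi : ℂ) else 0) *
        ((∫ s in Ioi 0, ((fun s => Real.sqrt 2 * s) ⁻¹' S).indicator
          (fun s => 2 * s * (radialProfile a b s * radialProfile c d s)) s : ℝ) : ℂ) := by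
  have hm : MeasurableSet {z : ℂ | ‖z‖ ∈ S} := measurable_norm hS
  have h20 : Real.sqrt 2 ≠ 0 := by simp
  set g : ℝ → ℝ := S.indicator fun r => r * (radialProfile a b (r / Real.sqrt 2) *
    radialProfile c d (r / Real.sqrt 2)) with hg
  have hint : ∫ r in Ioi 0, g r
      = ∫ s in Ioi 0, ((fun s => Real.sqrt 2 * s) ⁻¹' S).indicator
          (fun s => 2 * s * (radialProfile a b s * radialProfile c d s)) s := by
    have h := integral_comp_mul_left_Ioi g 0 (b := Real.sqrt 2) (by positivity)
    rw [mul_zero, smul_eq_mul] at h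
    have h' : ∫ r in Ioi 0, g r = Real.sqrt 2 * ∫ s in Ioi 0, g (Real.sqrt 2 * s) := by
      rw [h]; field_simp
    rw [h', ← integral_const_mul]
    congr 1
    ext s
    by_cases hs : Real.sqrt 2 * s ∈ S
    · rw [hg, indicator_of_mem hs, indicator_of_mem (show s ∈ _ ⁻¹' S from hs), mul_div_cancel_left₀ _ h20]
      linear_combination s * (radialProfile a b s * radialProfile c d s) *
        Real.mul_self_sqrt (show (0 : ℝ) ≤ 2 by norm_num)
    · rw [hg, indicator_of_notMem hs, indicator_of_notMem (show s ∉ _ ⁻¹' S from hs), mul_zero]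
  rw [← hint, ← integral_exp_pow_mul_conj_pow, ← integral_indicator hm,
    ← Complex.integral_comp_polarCoord_symm, ← integral_complex_ofReal, mul_assoc,
    mul_comm (∫ θ in Ioo (-Real.pi) Real.pi, _), ← setIntegral_prod_mul, ← integral_const_mul,
    polarCoord_target]
  refine setIntegral_congr_fun (measurableSet_Ioi.prod measurableSet_Ioo) fun p hp => ?_
  have hp0 : 0 < p.1 := hp.1
  set u := Complex.exp (p.2 * Complex.I) with hu
  have hu1 : ‖u‖ = 1 := Complex.norm_exp_ofReal_mul_I _
  have hz : Complex.polarCoord.symm p = (Real.sqrt 2 * (p.1 / Real.sqrt 2) : ℝ) * u := by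
    rw [Complex.polarCoord_symm_apply, mul_div_cancel₀ _ h20, hu, Complex.exp_mul_I]
    push_cast
    rfl
  have hn : ‖Complex.polarCoord.symm p‖ = p.1 := by
    rw [Complex.norm_polarCoord_symm, abs_of_pos hp0]
  have hpi : (Real.sqrt Real.pi : ℂ) * Real.sqrt Real.pi = Real.pi := by
    rw [← Complex.ofReal_mul, Real.mul_self_sqrt Real.pi_pos.le]
  by_cases hpS : p.1 ∈ S
  · rw [hg, indicator_of_mem hpS, indicator_of_mem (by rw [mem_ofPred_eq, hn]; exact hpS), hz,
      hermiteWigner_eq_radialProfile _ _ _ _ hu1, hermiteWigner_eq_radialProfile _ _ _ _ hu1]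
    simp only [map_mul, map_pow, Complex.conj_conj, Complex.conj_I, Complex.conj_ofReal,
      Complex.real_smul]
    push_cast
    rw [← hpi]
    ring
  · rw [hg, indicator_of_notMem hpS, indicator_of_notMem (by rw [mem_ofPred_eq, hn]; exact hpS)]
    simp

/-- The normalizing factor of the one-dimensional special Hermite function. -/
noncomputable def specialHermiteConst (a b : ℕ) : ℝ :=
  (2 * Real.pi) ^ (-(1 : ℝ) / 2) * ((Real.sqrt (a.factorial * Real.sqrt Real.pi))⁻¹ *
    (Real.sqrt (b.factorial * Real.sqrt Real.pi))⁻¹)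

/-- The factor `2 π²` is the angular integral `2 π` times the `π` coming from the two Gaussian
integrals `√π`. -/
theorem specialHermiteConst_sq (a b : ℕ) : specialHermiteConst a b ^ 2 * (2 * Real.pi ^ 2)
    = ((a.factorial : ℝ) * b.factorial)⁻¹ := by
  have h1 : ((2 * Real.pi) ^ (-(1 : ℝ) / 2)) ^ 2 = (2 * Real.pi)⁻¹ := by
    rw [← Real.rpow_natCast, ← Real.rpow_mul (by positivity), ← Real.rpow_neg_one]
    norm_num
  have h2 : Real.sqrt Real.pi * Real.sqrt Real.pi = Real.pi := Real.mul_self_sqrt Real.pi_pos.le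
  have h3 : 0 < Real.sqrt Real.pi := Real.sqrt_pos.2 Real.pi_pos
  rw [specialHermiteConst, mul_pow, mul_pow, h1, inv_pow, inv_pow, Real.sq_sqrt (by positivity),
    Real.sq_sqrt (by positivity)]
  have := Real.pi_pos
  have ha : (a.factorial : ℝ) ≠ 0 := by positivity
  have hb : (b.factorial : ℝ) ≠ 0 := by positivity
  field_simp
  rw [Real.sq_sqrt this.le]

/-- The special Hermite function on `ℂ`. -/
noncomputable def specialHermiteOne (a b : ℕ) (z : ℂ) : ℂ :=
  specialHermiteConst a b * hermiteWigner a b z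

theorem specialHermite_eq_prod {d : ℕ} (α β : Fin d → ℕ) (z : Fin d → ℂ) :
    specialHermite α β z = ∏ j, specialHermiteOne (α j) (β j) (z j) := by
  have h : ∀ ξ : Fin d → ℝ, Complex.exp (Complex.I * ((∑ j, (z j).re * ξ j : ℝ) : ℂ)) *
      (hermiteFunctionPi α (fun j => ξ j + (z j).im / 2) : ℂ) *
      (hermiteFunctionPi β (fun j => ξ j - (z j).im / 2) : ℂ)
      = ∏ j, (((Real.sqrt ((α j).factorial * Real.sqrt Real.pi))⁻¹ *
        (Real.sqrt ((β j).factorial * Real.sqrt Real.pi))⁻¹ : ℝ) : ℂ) *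
          wignerIntegrand (α j) (β j) (z j) (ξ j) := by
    intro ξ
    simp only [hermiteFunctionPi, Complex.ofReal_prod, Complex.ofReal_sum, Finset.mul_sum,
      Complex.exp_sum, ← Finset.prod_mul_distrib]
    refine Finset.prod_congr rfl fun j _ => ?_
    simp only [hermiteFunction_eq, wignerIntegrand]
    push_cast
    ring
  have h2 : (2 * Real.pi) ^ (-(d : ℝ) / 2) = ∏ _j : Fin d, (2 * Real.pi) ^ (-(1 : ℝ) / 2) := by
    rw [Finset.prod_const, Finset.card_univ, Fintype.card_fin, ← Real.rpow_natCast,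
      ← Real.rpow_mul (by positivity)]
    congr 1
    ring
  rw [specialHermite]
  simp only [h]
  rw [integral_fintype_prod_volume_eq_prod (𝕜 := ℂ) (fun j (ξ : ℝ) =>
    (((Real.sqrt ((α j).factorial * Real.sqrt Real.pi))⁻¹ *
        (Real.sqrt ((β j).factorial * Real.sqrt Real.pi))⁻¹ : ℝ) : ℂ) *
          wignerIntegrand (α j) (β j) (z j) ξ), h2, Complex.ofReal_prod, ← Finset.prod_mul_distrib]
  refine Finset.prod_congr rfl fun j _ => ?_
  rw [integral_const_mul, specialHermiteOne, specialHermiteConst, hermiteWigner]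
  push_cast
  ring

theorem setIntegral_conj_specialHermiteOne_mul (a b c d : ℕ) (S : Set ℂ) :
    ∫ z in S, conj (specialHermiteOne a b z) * specialHermiteOne c d z
      = specialHermiteConst a b * specialHermiteConst c d *
        ∫ z in S, conj (hermiteWigner a b z) * hermiteWigner c d z := by
  rw [← integral_const_mul]
  congr 1
  ext z
  simp only [specialHermiteOne, map_mul, Complex.conj_ofReal]
  ring

/-- Special Hermite functions of different angular momentum are orthogonal on every disc. -/
theorem setIntegral_conj_specialHermiteOne_mul_eq_zero {a b c d : ℕ} (h : a + d ≠ b + c)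
    {S : Set ℝ} (hS : MeasurableSet S) :
    ∫ z in {z : ℂ | ‖z‖ ∈ S}, conj (specialHermiteOne a b z) * specialHermiteOne c d z = 0 := by
  rw [setIntegral_conj_specialHermiteOne_mul, setIntegral_conj_hermiteWigner_mul _ _ _ _ hS,
    if_neg h]
  simp

theorem setIntegral_conj_specialHermiteOne_mul_self (a b : ℕ) {S : Set ℝ} (hS : MeasurableSet S) :
    ∫ z in {z : ℂ | ‖z‖ ∈ S}, conj (specialHermiteOne a b z) * specialHermiteOne a b z
      = ((((a.factorial : ℝ) * b.factorial)⁻¹ * ∫ s in Ioi 0,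
        ((fun s => Real.sqrt 2 * s) ⁻¹' S).indicator (fun s => 2 * s * radialProfile a b s ^ 2) s
          : ℝ) : ℂ) := by
  rw [setIntegral_conj_specialHermiteOne_mul, setIntegral_conj_hermiteWigner_mul _ _ _ _ hS,
    if_pos (add_comm a b), ← mul_pow, neg_mul, Complex.I_mul_I, neg_neg, one_pow, mul_one,
    ← specialHermiteConst_sq]
  simp only [pow_two (radialProfile _ _ _)]
  push_cast
  ring

theorem integral_conj_specialHermiteOne_mul (a b c d : ℕ) :
    ∫ z, conj (specialHermiteOne a b z) * specialHermiteOne c d z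
      = if a = c ∧ b = d then 1 else 0 := by
  have hu : {z : ℂ | ‖z‖ ∈ (univ : Set ℝ)} = univ := by ext; simp
  by_cases h : a + d = b + c
  · have hr := integral_radialProfile_mul a b c d (by omega)
    split_ifs with h2
    · obtain ⟨rfl, rfl⟩ := h2
      have := setIntegral_conj_specialHermiteOne_mul_self a b MeasurableSet.univ
      simp only [and_self, if_true, ← pow_two] at hr
      rw [hu, setIntegral_univ] at this
      rw [this]
      simp only [preimage_univ, indicator_univ]
      rw [hr, inv_mul_cancel₀ (by positivity), Complex.ofReal_one]
    · rw [← setIntegral_univ, setIntegral_conj_specialHermiteOne_mul, ← hu,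
        setIntegral_conj_hermiteWigner_mul _ _ _ _ MeasurableSet.univ]
      simp only [preimage_univ, indicator_univ]
      rw [hr, if_neg h2]
      simp
  · have := setIntegral_conj_specialHermiteOne_mul_eq_zero h MeasurableSet.univ
    rw [hu, setIntegral_univ] at this
    rw [this, if_neg]
    omega

/-- The mass of a special Hermite function on `ℂ` in the disc of radius `M`. -/
theorem setIntegral_conj_specialHermiteOne_mul_self_le (a b : ℕ) {M : ℝ} (hM : 1 ≤ M) :
    (∫ z in {z : ℂ | ‖z‖ ∈ Iic M},
      conj (specialHermiteOne a b z) * specialHermiteOne a b z).re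
      ≤ 6 * M / Real.sqrt (a + b + 1) := by
  have h2 : 1 ≤ Real.sqrt 2 := Real.one_le_sqrt.2 (by norm_num)
  have hf : 0 < (a.factorial : ℝ) * b.factorial := by positivity
  rw [setIntegral_conj_specialHermiteOne_mul_self _ _ measurableSet_Iic, Complex.ofReal_re]
  have hpre : (fun s => Real.sqrt 2 * s) ⁻¹' Iic M = Iic (M / Real.sqrt 2) := by
    ext s
    rw [mem_preimage, mem_Iic, mem_Iic, le_div_iff₀ (by positivity), mul_comm]
  rw [hpre, setIntegral_indicator measurableSet_Iic, Ioi_inter_Iic]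
  have h := integral_radialProfile_sq_le a b (M := M / Real.sqrt 2) (by
    rw [div_pow, Real.sq_sqrt (by norm_num)]; nlinarith) (by positivity)
  rw [inv_mul_le_iff₀ hf, mul_comm]
  refine h.trans ?_
  gcongr
  exact div_le_self (by linarith) h2

/-! ### Product structure on `ℂ^d`, balls and cylinders -/

variable {d : ℕ}

theorem setIntegral_conj_specialHermite_mul (α β α' β' : Fin d → ℕ) (A : Fin d → Set ℂ) :
    ∫ z in univ.pi A, conj (specialHermite α β z) * specialHermite α' β' z
      = ∏ j, ∫ z in A j,
        conj (specialHermiteOne (α j) (β j) z) * specialHermiteOne (α' j) (β' j) z := by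
  simp only [specialHermite_eq_prod, map_prod, ← Finset.prod_mul_distrib]
  rw [volume_pi, Measure.restrict_pi_pi]
  exact integral_fintype_prod_eq_prod (𝕜 := ℂ)
    (fun j z => conj (specialHermiteOne (α j) (β j) z) * specialHermiteOne (α' j) (β' j) z)

theorem orthonormal_specialHermiteLp :
    Orthonormal ℂ (fun p : (Fin d → ℕ) × (Fin d → ℕ) => specialHermiteLp p.1 p.2) := by
  classical
  rw [orthonormal_iff_ite]
  rintro ⟨α, β⟩ ⟨α', β'⟩
  have h : ⟪specialHermiteLp α β, specialHermiteLp α' β'⟫_ℂ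
      = ∫ z in univ.pi fun _ : Fin d => univ, conj (specialHermite α β z) * specialHermite α' β' z := by
    rw [pi_univ, setIntegral_univ, L2.inner_def]
    refine integral_congr_ae ?_
    filter_upwards [(memLp_specialHermite α β).coeFn_toLp,
      (memLp_specialHermite α' β').coeFn_toLp] with z h1 h2
    rw [specialHermiteLp, specialHermiteLp, h1, h2, RCLike.inner_apply, mul_comm]
  simp only [h, setIntegral_conj_specialHermite_mul, setIntegral_univ,
    integral_conj_specialHermiteOne_mul]
  split_ifs with he
  · simp only [Prod.mk.injEq] at he
    obtain ⟨rfl, rfl⟩ := he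
    simp
  · have : ∃ j, ¬ (α j = α' j ∧ β j = β' j) := by
      by_contra! hcon
      exact he (Prod.ext (funext fun j => (hcon j).1) (funext fun j => (hcon j).2))
    obtain ⟨j, hj⟩ := this
    exact Finset.prod_eq_zero (Finset.mem_univ j) (if_neg hj)

/-- The set of `z ∈ ℂ^d` whose `j`-th coordinate has modulus at most `M`. -/
def diskCylinder (j : Fin d) (M : ℝ) : Set (Fin d → ℂ) :=
  univ.pi fun i => {z : ℂ | ‖z‖ ∈ if i = j then Iic M else univ}

theorem euclideanBall_subset_diskCylinder (j : Fin d) (M : ℝ) :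
    euclideanBall d M ⊆ diskCylinder j M := by
  intro z hz i _
  by_cases h : i = j
  · subst h
    simp only [if_true]
    have hz' : Real.sqrt (∑ j, ‖z j‖ ^ 2) ≤ M := hz
    refine le_trans ?_ hz'
    refine Real.le_sqrt_of_sq_le ?_
    exact Finset.single_le_sum (f := fun j => ‖z j‖ ^ 2) (fun _ _ => by positivity)
      (Finset.mem_univ i)
  · simp [h]

/-- Restriction of square integrable functions to a set. -/
noncomputable abbrev restrictL2 (S : Set (Fin d → ℂ)) :
    Lp ℂ 2 (volume : Measure (Fin d → ℂ)) →L[ℂ] Lp ℂ 2 (volume.restrict S) :=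
  LpToLpRestrictCLM (Fin d → ℂ) ℂ ℂ volume 2 S

theorem inner_restrictL2_specialHermiteLp (S : Set (Fin d → ℂ)) (α β α' β' : Fin d → ℕ) :
    ⟪restrictL2 S (specialHermiteLp α β), restrictL2 S (specialHermiteLp α' β')⟫_ℂ
      = ∫ z in S, conj (specialHermite α β z) * specialHermite α' β' z := by
  rw [L2.inner_def]
  refine integral_congr_ae ?_
  filter_upwards [LpToLpRestrictCLM_coeFn ℂ S (specialHermiteLp α β),
    LpToLpRestrictCLM_coeFn ℂ S (specialHermiteLp α' β'),
    ae_restrict_of_ae (memLp_specialHermite α β).coeFn_toLp,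
    ae_restrict_of_ae (memLp_specialHermite α' β').coeFn_toLp] with z h1 h2 h3 h4
  rw [h1, h2, specialHermiteLp, specialHermiteLp, h3, h4, RCLike.inner_apply, mul_comm]

theorem norm_restrictL2_sq (S : Set (Fin d → ℂ)) (f : Lp ℂ 2 (volume : Measure (Fin d → ℂ))) :
    ‖restrictL2 S f‖ ^ 2 = ∫ z in S, ‖f z‖ ^ 2 := by
  rw [← inner_self_eq_norm_sq (𝕜 := ℂ), L2.inner_def, ← integral_re (L2.integrable_inner _ _)]
  refine integral_congr_ae ?_
  filter_upwards [LpToLpRestrictCLM_coeFn ℂ S f] with z h1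
  rw [h1, inner_self_eq_norm_sq]

theorem norm_restrictL2_mono {S T : Set (Fin d → ℂ)} (h : S ⊆ T)
    (f : Lp ℂ 2 (volume : Measure (Fin d → ℂ))) : ‖restrictL2 S f‖ ≤ ‖restrictL2 T f‖ := by
  refine le_of_sq_le_sq ?_ (norm_nonneg _)
  rw [norm_restrictL2_sq, norm_restrictL2_sq]
  refine setIntegral_mono_set ?_ (Eventually.of_forall fun z => by positivity) h.eventuallyLE
  exact ((memLp_two_iff_integrable_sq_norm (Lp.memLp f).1).1 (Lp.memLp f)).integrableOn

/-- If the product of coordinate integrals is nonzero, orthonormality on `ℂ` identifies all indices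
away from `j`; equality of the sums then gives `β j = β' j`, and angular momentum on the disc gives
`α j = α' j`. The ball has no such product structure, whence the passage to cylinders. -/
theorem setIntegral_diskCylinder_eq_zero (j : Fin d) (M : ℝ) {α β α' β' : Fin d → ℕ}
    (hβ : ∑ i, β i = ∑ i, β' i) (h : ¬ (α = α' ∧ β = β')) :
    ∫ z in diskCylinder j M, conj (specialHermite α β z) * specialHermite α' β' z = 0 := by
  rw [diskCylinder, setIntegral_conj_specialHermite_mul, Finset.prod_eq_zero_iff]
  by_contra! hcon
  have h1 : ∀ i, i ≠ j → α i = α' i ∧ β i = β' i := by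
    intro i hi
    have h2 := hcon i (Finset.mem_univ i)
    have hu : {z : ℂ | ‖z‖ ∈ (univ : Set ℝ)} = univ := by ext; simp
    rw [if_neg hi, hu, setIntegral_univ, integral_conj_specialHermiteOne_mul] at h2
    by_contra hne
    exact h2 (if_neg hne)
  have hβj : β j = β' j := by
    have hs : ∑ i ∈ Finset.univ.erase j, β i = ∑ i ∈ Finset.univ.erase j, β' i :=
      Finset.sum_congr rfl fun i hi => (h1 i (Finset.ne_of_mem_erase hi)).2
    rw [← Finset.add_sum_erase _ _ (Finset.mem_univ j),
      ← Finset.add_sum_erase _ β' (Finset.mem_univ j), hs] at hβ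
    exact Nat.add_right_cancel hβ
  have hαj : α j = α' j := by
    have h2 := hcon j (Finset.mem_univ j)
    by_contra hne
    exact h2 (setIntegral_conj_specialHermiteOne_mul_eq_zero (by omega)
      (by rw [if_pos rfl]; exact measurableSet_Iic))
  refine h ⟨funext fun i => ?_, funext fun i => ?_⟩ <;> by_cases hi : i = j
  · rw [hi, hαj]
  · exact (h1 i hi).1
  · rw [hi, hβj]
  · exact (h1 i hi).2

theorem norm_restrictL2_diskCylinder_sq_le (j : Fin d) {M : ℝ} (hM : 1 ≤ M) (α β : Fin d → ℕ) :
    ‖restrictL2 (diskCylinder j M) (specialHermiteLp α β)‖ ^ 2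
      ≤ 6 * M / Real.sqrt (α j + β j + 1) := by
  rw [← inner_self_eq_norm_sq (𝕜 := ℂ), inner_restrictL2_specialHermiteLp, diskCylinder,
    setIntegral_conj_specialHermite_mul, ← Finset.mul_prod_erase _ _ (Finset.mem_univ j),
    Finset.prod_eq_one, mul_one, if_pos rfl]
  · exact setIntegral_conj_specialHermiteOne_mul_self_le _ _ hM
  · intro i hi
    have hu : {z : ℂ | ‖z‖ ∈ (univ : Set ℝ)} = univ := by ext; simp
    rw [if_neg (Finset.ne_of_mem_erase hi), hu, setIntegral_univ,
      integral_conj_specialHermiteOne_mul, if_pos ⟨rfl, rfl⟩]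

/-! ### Operator bounds on orthonormal expansions -/

section Hilbert

variable {ι H K : Type*} [NormedAddCommGroup H] [InnerProductSpace ℂ H]
  [NormedAddCommGroup K] [InnerProductSpace ℂ K]

theorem norm_sum_smul_sq_of_pairwise_inner_eq_zero {w : ι → K} (s : Finset ι)
    (hw : ∀ i ∈ s, ∀ j ∈ s, i ≠ j → ⟪w i, w j⟫_ℂ = 0) (c : ι → ℂ) :
    ‖∑ i ∈ s, c i • w i‖ ^ 2 = ∑ i ∈ s, ‖c i‖ ^ 2 * ‖w i‖ ^ 2 := by
  classical
  induction s using Finset.induction_on with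
  | empty => simp
  | insert i s hi ih =>
    rw [Finset.sum_insert hi, Finset.sum_insert hi,
      ← ih fun j hj k hk => hw j (Finset.mem_insert_of_mem hj) k (Finset.mem_insert_of_mem hk)]
    have h0 : ⟪c i • w i, ∑ j ∈ s, c j • w j⟫_ℂ = 0 := by
      rw [inner_sum]
      refine Finset.sum_eq_zero fun j hj => ?_
      rw [inner_smul_left, inner_smul_right, hw i (Finset.mem_insert_self i s) j
        (Finset.mem_insert_of_mem hj) (fun h => hi (h ▸ hj))]
      simp
    have := norm_add_sq_eq_norm_sq_add_norm_sq_of_inner_eq_zero _ _ h0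
    rw [pow_two, this, norm_smul]
    ring

theorem summable_inner_smul_of_orthonormal [CompleteSpace H] {e : ι → H} (he : Orthonormal ℂ e)
    (f : H) : Summable fun i => ⟪e i, f⟫_ℂ • e i := by
  have h := he.orthogonalFamily.summable_iff_norm_sq_summable (fun i => ⟪e i, f⟫_ℂ)
  simp only [LinearIsometry.toSpanSingleton_apply] at h
  exact h.2 (he.inner_products_summable f)

/-- A bound for an operator on the span of an orthonormal family which splits into finitely many
parts, the operator being dominated on each part by one that keeps that part orthogonal. -/
theorem norm_tsum_inner_smul_le [CompleteSpace H] {κ : Type*} [Fintype κ] {e : ι → H}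
    (he : Orthonormal ℂ e) (J : ι → κ) {L : κ → Type*} [∀ j, NormedAddCommGroup (L j)]
    [∀ j, InnerProductSpace ℂ (L j)] (T : H →L[ℂ] K) (R : ∀ j, H →L[ℂ] L j)
    (hT : ∀ j v, ‖T v‖ ≤ ‖R j v‖)
    (horth : ∀ i i', i ≠ i' → J i = J i' → ⟪R (J i) (e i), R (J i) (e i')⟫_ℂ = 0)
    {B : ℝ} (hB : 0 ≤ B) (hn : ∀ i, ‖R (J i) (e i)‖ ^ 2 ≤ B) (f : H) :
    ‖T (∑' i, ⟪e i, f⟫_ℂ • e i)‖ ≤ Fintype.card κ * (Real.sqrt B * ‖f‖) := by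
  classical
  have hs := (summable_inner_smul_of_orthonormal he f).hasSum
  -- Continuity of `T` reduces the bound to finite partial sums, which can be regrouped by the value
  -- of `J`; the triangle inequality over the groups costs the factor `Fintype.card κ`, and each
  -- group is handled by Pythagoras and Bessel.
  have hlim : Tendsto (fun s : Finset ι => ‖T (∑ i ∈ s, ⟪e i, f⟫_ℂ • e i)‖) atTop
      (𝓝 ‖T (∑' i, ⟪e i, f⟫_ℂ • e i)‖) := ((T.continuous.tendsto _).comp hs).norm
  refine le_of_tendsto' hlim fun s => ?_
  rw [← Finset.sum_fiberwise s J, map_sum]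
  refine (norm_sum_le _ _).trans ?_
  rw [← nsmul_eq_mul, ← Finset.card_univ]
  refine Finset.sum_le_card_nsmul _ _ _ fun j _ => (hT j _).trans ?_
  refine le_of_sq_le_sq ?_ (by positivity)
  rw [map_sum, mul_pow, Real.sq_sqrt hB]
  simp only [map_smul]
  rw [norm_sum_smul_sq_of_pairwise_inner_eq_zero (w := fun i => R j (e i))]
  · calc _ ≤ ∑ i ∈ s with J i = j, ‖⟪e i, f⟫_ℂ‖ ^ 2 * B := by
          refine Finset.sum_le_sum fun i hi => ?_
          have : J i = j := (Finset.mem_filter.1 hi).2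
          subst this
          gcongr
          exact hn i
      _ ≤ B * ‖f‖ ^ 2 := by
          rw [← Finset.sum_mul, mul_comm]
          gcongr
          exact he.sum_inner_products_le f
  · intro i hi i' hi' hne
    have h1 : J i = j := (Finset.mem_filter.1 hi).2
    have h2 : J i' = j := (Finset.mem_filter.1 hi').2
    subst h1
    exact horth i i' hne h2.symm

end Hilbert

/-! ### The spectral projection at a fixed level -/

variable {d : ℕ}

theorem orthonormal_specialHermiteLp_level (μ : ℕ) :
    Orthonormal ℂ (fun p : {β : Fin d → ℕ // 2 * (∑ j, β j) + d = μ} × (Fin d → ℕ) =>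
      specialHermiteLp p.2 p.1.1) :=
  orthonormal_specialHermiteLp.comp (fun p : {β : Fin d → ℕ // 2 * (∑ j, β j) + d = μ} ×
    (Fin d → ℕ) => (p.2, p.1.1)) fun p q h => by
      simp only [Prod.mk.injEq] at h
      exact Prod.ext (Subtype.ext h.2) h.1

/-- The iterated sum may be merged because the double family is an orthonormal expansion, hence
summable. -/
theorem spectralProjection_eq_tsum (μ : ℕ) (f : Lp ℂ 2 (volume : Measure (Fin d → ℂ))) :
    spectralProjection μ f
      = ∑' p : {β : Fin d → ℕ // 2 * (∑ j, β j) + d = μ} × (Fin d → ℕ),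
        ⟪specialHermiteLp p.2 p.1.1, f⟫_ℂ • specialHermiteLp p.2 p.1.1 :=
  (summable_inner_smul_of_orthonormal (orthonormal_specialHermiteLp_level μ) f).tsum_prod.symm

theorem summable_inner_smul_specialHermiteLp (β : Fin d → ℕ)
    (f : Lp ℂ 2 (volume : Measure (Fin d → ℂ))) :
    Summable fun α : Fin d → ℕ => ⟪specialHermiteLp α β, f⟫_ℂ • specialHermiteLp α β :=
  summable_inner_smul_of_orthonormal
    (orthonormal_specialHermiteLp.comp (fun α => (α, β)) fun _ _ h => (Prod.mk.inj h).1) f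

/-- The largest coordinate is at least the average. -/
theorem exists_level_le_mul_coordinate (hd : 1 ≤ d) (β : Fin d → ℕ) :
    ∃ j, 2 * (∑ i, β i) + d ≤ 2 * d * (β j + 1) := by
  have : Nonempty (Fin d) := ⟨⟨0, hd⟩⟩
  obtain ⟨j, hj⟩ := Finite.exists_max β
  refine ⟨j, ?_⟩
  have := Finset.sum_le_card_nsmul Finset.univ β (β j) fun i _ => hj i
  simp only [Finset.card_univ, Fintype.card_fin, smul_eq_mul] at this
  nlinarith

theorem norm_restrictL2_spectralProjection_le (hd : 1 ≤ d) (μ : ℕ) (hμ : 0 < μ) {M : ℝ}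
    (hM : 1 ≤ M) (f : Lp ℂ 2 (volume : Measure (Fin d → ℂ))) :
    ‖restrictL2 (euclideanBall d M) (spectralProjection μ f)‖
      ≤ d * (Real.sqrt (6 * M * (Real.sqrt (2 * d) / Real.sqrt μ)) * ‖f‖) := by
  choose J hJ using exists_level_le_mul_coordinate (d := d) hd
  have h := norm_tsum_inner_smul_le (orthonormal_specialHermiteLp_level (d := d) μ)
    (fun p => J p.1.1) (restrictL2 (euclideanBall d M)) (fun j => restrictL2 (diskCylinder j M))
    (fun j v => norm_restrictL2_mono (euclideanBall_subset_diskCylinder j M) v) ?_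
    (B := 6 * M * (Real.sqrt (2 * d) / Real.sqrt μ)) (by positivity) ?_ f
  · rw [Fintype.card_fin, ← spectralProjection_eq_tsum] at h
    exact h
  · rintro ⟨⟨β, hβ⟩, α⟩ ⟨⟨β', hβ'⟩, α'⟩ hne -
    rw [inner_restrictL2_specialHermiteLp]
    refine setIntegral_diskCylinder_eq_zero _ _ (show ∑ i, β i = ∑ i, β' i by omega) ?_
    rintro ⟨rfl, rfl⟩
    exact hne rfl
  · rintro ⟨⟨β, hβ⟩, α⟩
    refine (norm_restrictL2_diskCylinder_sq_le _ hM α β).trans ?_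
    rw [div_eq_mul_inv]
    gcongr
    -- Only the size of `β (J β)` is used; `α (J β) ≥ 0` is discarded, so the bound is uniform in
    -- `α`.
    have hle : (μ : ℝ) ≤ 2 * d * (α (J β) + β (J β) + 1) := by
      have h1 : μ ≤ 2 * d * (β (J β) + 1) := hβ ▸ hJ β
      have h2 : (μ : ℝ) ≤ 2 * d * (β (J β) + 1) := by exact_mod_cast h1
      refine h2.trans ?_
      gcongr
      linarith [(Nat.cast_nonneg (α (J β)) : (0 : ℝ) ≤ _)]
    have hμ' : 0 < Real.sqrt μ := Real.sqrt_pos.2 (by exact_mod_cast hμ)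
    rw [inv_le_iff_one_le_mul₀ (by positivity), div_mul_eq_mul_div, le_div_iff₀ hμ', one_mul,
      ← Real.sqrt_mul (by positivity)]
    exact Real.sqrt_le_sqrt hle

end TwistedLaplacian

theorem lemma2p1 (d : ℕ) (hd : 1 ≤ d) :
    ∃ C : ℝ, 0 < C ∧ ∀ μ : ℕ, (∃ k : ℕ, μ = 2 * k + d) →
      ∀ f : Lp ℂ 2 (volume : Measure (Fin d → ℂ)),
        (∀ β : Fin d → ℕ, 2 * (∑ j, β j) + d = μ →
          Summable fun α : Fin d → ℕ =>
            ⟪TwistedLaplacian.specialHermiteLp α β, f⟫_ℂ •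
              TwistedLaplacian.specialHermiteLp α β) ∧
        ∀ M : ℝ, 1 ≤ M →
          ∫ z in TwistedLaplacian.euclideanBall d M,
              ‖TwistedLaplacian.spectralProjection μ f z‖ ^ 2
            ≤ C * M * (μ : ℝ) ^ (-(1 / 2) : ℝ) * ‖f‖ ^ 2 := by
  have hd0 : (0 : ℝ) < d := by exact_mod_cast hd
  -- Here `d²` is the squared number of parts, `6` comes from the disc estimate and `√(2 d)` from `μ
  -- ≤ 2 d (β j + 1)`.
  refine ⟨d ^ 2 * (6 * Real.sqrt (2 * d)), by positivity, ?_⟩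
  rintro μ ⟨k, rfl⟩ f
  refine ⟨fun β _ => TwistedLaplacian.summable_inner_smul_specialHermiteLp β f, fun M hM => ?_⟩
  have h := TwistedLaplacian.norm_restrictL2_spectralProjection_le hd (2 * k + d) (by omega) hM f
  rw [← TwistedLaplacian.norm_restrictL2_sq]
  refine (pow_le_pow_left₀ (norm_nonneg _) h 2).trans (le_of_eq ?_)
  rw [mul_pow, mul_pow, Real.sq_sqrt (by positivity), Real.rpow_neg (Nat.cast_nonneg _),
    ← Real.sqrt_eq_rpow]
  ring
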